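/- For a permutation $p=p_1p_2\cdots p_n$ of $\{1,\dots,n\}$, say that $p$ avoids $1342$ if there are no positions $a<b<c<d$ with $p_a<p_d<p_b<p_c$, and that $p$ is indecomposable if there is no $k$ with $1\le k<n$ such that every one of $p_1,\dots,p_k$ is larger than every one of $p_{k+1},\dots,p_n$. Let $s_n=S_n(1342)$ be the number of $1342$-avoiding permutations of length $n$ (so $s_0=1$), let $I_n(1342)$ be the number of indecomposable ones among them, and let $$t_1=1,\qquad t_n=3\cdot 2^{n-2}\cdot\frac{(2n-2)!}{(n+1)!\,(n-1)!}\quad (n\ge 2),\qquad F(x)=\sum_{n\ge 1}t_nx^n,\qquad H(x)=\sum_{n\ge 0}s_nx^n .$$ Theorem. For every $n\ge 1$ we have $I_n(1342)=t_n$. Moreover, as formal power series over $\mathbb{Q}$ (quotients being taken in the field of formal Laurent series $\mathbb{Q}((x))$, and $(1-8x)^{3/2}=\sum_{k\ge0}\binom{3/2}{k}(-8x)^k$), $$F(x)=\frac{8x^2+12x-1+(1-8x)^{3/2}}{32x},$$ $$H(x)=\sum_{i\ge 0}F(x)^i=\frac{1}{1-F(x)}=\frac{32x}{-8x^2+20x+1-(1-8x)^{3/2}},$$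 where the infinite sum converges in the sense that each coefficient of its partial sums is eventually constant. -/

import Mathlib

open scoped Nat PowerSeries LaurentSeries

namespace Avoid1342

/-- The permutation `p` of length `n` contains the pattern `q` of length `k`: there are positions
`e 0 < e 1 < ... < e (k - 1)` at which the entries of `p` are in the same relative order as the
entries of `q`. -/
def Contains {k n : ℕ} (q : Equiv.Perm (Fin k)) (p : Equiv.Perm (Fin n)) : Prop :=
  ∃ e : Fin k ↪o Fin n, ∀ a b : Fin k, p (e a) < p (e b) ↔ q a < q b

/-- `p` avoids the pattern `q`. -/
def Avoids {k n : ℕ} (q : Equiv.Perm (Fin k)) (p : Equiv.Perm (Fin n)) : Prop :=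
  ¬ Contains q p

/-- The pattern 1342; positions and values are numbered from `0`. -/
def pattern1342 : Equiv.Perm (Fin 4) where
  toFun := ![0, 2, 3, 1]
  invFun := ![0, 3, 1, 2]
  left_inv := by decide
  right_inv := by decide

/-- `p` is indecomposable: it cannot be cut into two nonempty parts (the first `k` entries and the
remaining ones) so that every entry before the cut is larger than every entry after the cut. -/
def Indecomposable {n : ℕ} (p : Equiv.Perm (Fin n)) : Prop :=
  ¬ ∃ k : ℕ, 0 < k ∧ k < n ∧ ∀ i j : Fin n, (i : ℕ) < k → k ≤ (j : ℕ) → p j < p i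

/-- `S_n(q)`, the number of permutations of length `n` that avoid `q`. -/
noncomputable def numAvoiding {k : ℕ} (q : Equiv.Perm (Fin k)) (n : ℕ) : ℕ :=
  Nat.card {p : Equiv.Perm (Fin n) // Avoids q p}

/-- `I_n(q)`, the number of indecomposable permutations of length `n` that avoid `q`. -/
noncomputable def numIndecomposableAvoiding {k : ℕ} (q : Equiv.Perm (Fin k)) (n : ℕ) : ℕ :=
  Nat.card {p : Equiv.Perm (Fin n) // Indecomposable p ∧ Avoids q p}

/-- The numbers `t_1 = 1` and `t_n = 3 * 2 ^ (n - 2) * (2 n - 2)! / ((n + 1)! (n - 1)!)` for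
`n ≥ 2`; the value at `0` is set to `0`, since their generating function starts at `n = 1`. -/
def t : ℕ → ℚ
  | 0 => 0
  | 1 => 1
  | m + 2 => 3 * 2 ^ m * ((2 * m + 2)! : ℚ) / (((m + 3)! : ℚ) * ((m + 1)! : ℚ))

/-- `F(x) = ∑_{n ≥ 1} t_n x^n`. -/
def F : ℚ⟦X⟧ := PowerSeries.mk t

/-- `H(x) = ∑_{n ≥ 0} S_n(1342) x^n`. -/
noncomputable def H : ℚ⟦X⟧ := PowerSeries.mk fun n => (numAvoiding pattern1342 n : ℚ)

/-- The formal power series `(1 - 8x)^(3/2)`, that is, the binomial series `(1 + x)^(3/2)` with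
`-8x` in place of `x`. -/
noncomputable def oneSubEightXPow : ℚ⟦X⟧ :=
  PowerSeries.rescale (-8 : ℚ) (PowerSeries.binomialSeries ℚ (3 / 2 : ℚ))

/-- The series `∑_{i ≥ 0} f i` of formal power series converges to `g` in the formal sense: each
coefficient of its partial sums is eventually constant, equal to that coefficient of `g`. -/
def IsFormalSum (f : ℕ → ℚ⟦X⟧) (g : ℚ⟦X⟧) : Prop :=
  ∀ n : ℕ, ∃ N : ℕ, ∀ M : ℕ, N ≤ M →
    PowerSeries.coeff n (∑ i ∈ Finset.range M, f i) = PowerSeries.coeff n g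

/-- The inclusion of formal power series into the field of formal Laurent series, in which quotients
of formal power series are formed. -/
noncomputable def toLaurent (f : ℚ⟦X⟧) : ℚ⸨X⸩ := HahnSeries.ofPowerSeries ℤ ℚ f

/-- The variable `x` as a formal Laurent series. -/
noncomputable def x : ℚ⸨X⸩ := toLaurent PowerSeries.X

end Avoid1342

/-!
The proof sets up a functional equation for the generating function of all avoiders and solves it
by the quadratic method; the indecomposable avoiders are read off at the end.

A quarter turn of the diagram (`quarterTurn`) turns permutations that avoid 1342 into lists that
avoid 3241, and skew sums into direct sums. Lists are arrangements of an arbitrary integer interval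
`[o, o + n)`, so that the parts of a decomposition need no standardisation. Let `free l` be the
length of the longest prefix of `l` that avoids 213. Write a nonempty list as `v :: w`, and let
`R` be the list of the entries of `w` above `v`. The list avoids 3241 exactly if `R` does and `w`
has the form `B₀ r₀ B₁ r₁ ⋯ Bₑ rₑ rₑ₊₁ ⋯`, where `e = free R`, `R = r₀ r₁ ⋯`, and the `Bₐ` are
possibly empty avoiders on consecutive intervals below `v` (`mem_avoiders_succ`, `shuf_zero`,
`shuf_succ`): a smaller entry after a larger one must exceed all smaller entries before that larger
one, and no smaller entry may come after an occurrence of 213 in `R`. Moreover, `free (v :: w)` is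
`1 + a + free Bₐ` for the first nonempty block `Bₐ`, and `1 + e` if all blocks are empty
(`free_append_of_gt`, `free_cons_of_lt`).

With `Y u = ∑ x ^ |l| * u ^ free l` and `h = Y 1`, the shuffles for a given `e` have the
generating function `K u e`, for which `(u - h) * K u e` is an explicit combination of `u ^ e` and
`h ^ (e + 1)` (`sub_mul_K`). Summing over `R` gives the `functional_equation`
`x u² Y² - h (u - 1 + x u) Y + h (u - 1) = 0`. It may be specialised to any power series `u` in
`x`. For `u = 1 + x V` the discriminant is, up to a factor, the cubic
`h ((1 + x) V + 1)² - 4 V (1 + x V)²`; it is a square that vanishes for a certain power series `V`,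
hence has a double root there (`exists_double_root`). Eliminating `V` yields
`h (1 + 20 x - 8 x² - (1 - 8 x)^(3/2)) = 32 x` (`Y_one_mul`).

The closed form of `F` follows by comparing coefficients (`F_eq`), and it shows that
`h (1 - F) = 1`. Since every nonempty avoider is uniquely the direct sum of an indecomposable one and an arbitrary
one, the generating function `I` of the indecomposable avoiders satisfies `h = 1 + I h`, so `I = F`
(`mk_card_indecAvoiders`).
-/

namespace Avoid1342

open Finset.HasAntidiagonal (antidiagonal mem_antidiagonal)

/-! ### Lists avoiding 213 and 3241 -/

/-- The list `l` has no three entries, in this order of positions, in the relative order of 213. -/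
def Av213 (l : List ℕ) : Prop :=
  ∀ a b c : ℕ, [a, b, c].Sublist l → ¬ (b < a ∧ a < c)

/-- The list `l` has no four entries, in this order of positions, in the relative order of 3241. -/
def Av3241 (l : List ℕ) : Prop :=
  ∀ a b c d : ℕ, [a, b, c, d].Sublist l → ¬ (d < b ∧ b < a ∧ a < c)

/-- The list `l` is an arrangement of the integer interval `[o, o + n)`. -/
def Fills (o n : ℕ) (l : List ℕ) : Prop :=
  l.Nodup ∧ ∀ y, y ∈ l ↔ o ≤ y ∧ y < o + n

open Classical in
/-- The length of the longest prefix of `l` that avoids 213. -/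
noncomputable def free (l : List ℕ) : ℕ :=
  Nat.findGreatest (fun k => Av213 (l.take k)) l.length

open Classical in
/-- The arrangements of `[o, o + n)` that avoid 3241. -/
noncomputable def avoiders (o n : ℕ) : Finset (List ℕ) :=
  (List.range' o n).permutations.toFinset.filter Av3241

theorem Av213.sublist {l l' : List ℕ} (h : Av213 l) (hl : l'.Sublist l) : Av213 l' :=
  fun a b c hs => h a b c (hs.trans hl)

theorem Av3241.sublist {l l' : List ℕ} (h : Av3241 l) (hl : l'.Sublist l) : Av3241 l' :=
  fun a b c d hs => h a b c d (hs.trans hl)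

theorem av213_nil : Av213 [] := by
  intro a b c h; simp at h

theorem le_free_iff {k : ℕ} {l : List ℕ} :
    k ≤ free l ↔ k ≤ l.length ∧ Av213 (l.take k) := by
  classical
  constructor
  · intro h
    have hs : Av213 (l.take (free l)) :=
      Nat.findGreatest_spec (P := fun k => Av213 (l.take k)) (Nat.zero_le _)
        (by simpa using av213_nil)
    refine ⟨h.trans (Nat.findGreatest_le _), hs.sublist ?_⟩
    exact List.take_sublist_take_left h
  · rintro ⟨h1, h2⟩
    exact Nat.le_findGreatest h1 h2

theorem free_le_length (l : List ℕ) : free l ≤ l.length := (le_free_iff.1 le_rfl).1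

theorem free_nil : free [] = 0 := Nat.le_zero.1 (free_le_length [])

theorem fills_iff_perm {o n : ℕ} {l : List ℕ} : Fills o n l ↔ l.Perm (List.range' o n) := by
  constructor
  · rintro ⟨h1, h2⟩
    rw [List.perm_ext_iff_of_nodup h1 List.nodup_range']
    intro y; rw [h2, List.mem_range'_1]
  · intro h
    refine ⟨h.nodup_iff.2 List.nodup_range', fun y => ?_⟩
    rw [h.mem_iff, List.mem_range'_1]

theorem Fills.length {o n : ℕ} {l : List ℕ} (h : Fills o n l) : l.length = n := by
  simpa using (fills_iff_perm.1 h).length_eq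

theorem mem_avoiders {o n : ℕ} {l : List ℕ} : l ∈ avoiders o n ↔ Fills o n l ∧ Av3241 l := by
  classical
  simp [avoiders, fills_iff_perm]

theorem fills_nil (o : ℕ) : Fills o 0 [] := ⟨List.nodup_nil, fun y => by simp⟩

theorem fills_zero_iff {o : ℕ} {l : List ℕ} : Fills o 0 l ↔ l = [] :=
  ⟨fun h => List.length_eq_zero_iff.1 h.length, fun h => h ▸ fills_nil o⟩

theorem avoiders_zero (o : ℕ) : avoiders o 0 = {[]} := by
  ext l
  rw [mem_avoiders, fills_zero_iff, Finset.mem_singleton]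
  refine ⟨fun h => h.1, fun h => ⟨h, ?_⟩⟩
  subst h
  intro a b c d h; simp at h

/-- Concatenating an arrangement of `[o, o + b)` and one of `[o + b, o + b + c)`. -/
theorem Fills.append {o b c : ℕ} {B C : List ℕ} (hB : Fills o b B) (hC : Fills (o + b) c C) :
    Fills o (b + c) (B ++ C) := by
  refine ⟨List.nodup_append.2 ⟨hB.1, hC.1, ?_⟩, fun y => ?_⟩
  · intro x hx y hy
    have := (hB.2 x).1 hx
    have := (hC.2 y).1 hy
    omega
  · rw [List.mem_append, hB.2, hC.2]; omega

/-- If an arrangement of an interval is cut so that all entries before the cut are smaller than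
all entries after it, then both parts are arrangements of intervals. -/
theorem Fills.of_append {o n : ℕ} {B C : List ℕ} (h : Fills o n (B ++ C))
    (hlt : ∀ s ∈ B, ∀ s' ∈ C, s < s') :
    ∃ c, B.length + c = n ∧ Fills o B.length B ∧ Fills (o + B.length) c C := by
  have hlen := h.length
  rw [List.length_append] at hlen
  obtain ⟨hB, hC, hd⟩ := List.nodup_append.1 h.1
  have hBset : B.toFinset = Finset.Ico o (o + B.length) := by
    apply Finset.eq_of_subset_of_card_le
    · intro y hy
      have hyB : y ∈ B := by simpa using hy
      have hy' := (h.2 y).1 (by simp [hyB])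
      have hsub : Finset.Icc o y ⊆ B.toFinset := by
        intro y' hy'
        rw [Finset.mem_Icc] at hy'
        have hm := (h.2 y').2 (by omega)
        rcases List.mem_append.1 hm with hm | hm
        · simpa using hm
        · have := hlt y hyB y' hm; omega
      have := Finset.card_le_card hsub
      rw [List.toFinset_card_of_nodup hB, Nat.card_Icc] at this
      rw [Finset.mem_Ico]; omega
    · rw [List.toFinset_card_of_nodup hB, Nat.card_Ico]; omega
  have hB' : ∀ y, y ∈ B ↔ o ≤ y ∧ y < o + B.length := fun y => by
    rw [← Finset.mem_Ico, ← hBset]; simp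
  refine ⟨C.length, hlen, ⟨hB, hB'⟩, hC, fun y => ⟨fun hy => ?_, fun hy => ?_⟩⟩
  · have h1 := (h.2 y).1 (by simp [hy])
    have h2 : ¬ y ∈ B := fun h3 => hd y h3 y hy rfl
    rw [hB'] at h2; omega
  · have h1 := (h.2 y).2 (by omega)
    rcases List.mem_append.1 h1 with h1 | h1
    · rw [hB'] at h1; omega
    · exact h1

/-- A direct sum avoids the indecomposable pattern 3241 as soon as both summands do. -/
theorem Av3241.append {B C : List ℕ} (hB : Av3241 B) (hC : Av3241 C)
    (hlt : ∀ s ∈ B, ∀ s' ∈ C, s < s') : Av3241 (B ++ C) := by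
  intro a b c d hs hp
  obtain ⟨l₁, l₂, he, h1, h2⟩ := List.sublist_append_iff.1 hs
  have key : a ∈ B → d ∈ C → False := fun ha hd => by have := hlt a ha d hd; omega
  rcases l₁ with _ | ⟨a', l₁⟩
  · exact hC a b c d (by simpa [he] using h2) hp
  · obtain ⟨rfl, he⟩ := List.cons.inj he
    rcases List.eq_nil_or_concat l₂ with rfl | ⟨l₃, d', rfl⟩
    · exact hB a b c d (by simpa [he] using h1) hp
    · have hd : d = d' := by
        have h3 : [b, c] ++ [d] = (l₁ ++ l₃) ++ [d'] := by simpa using he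
        simpa using (List.append_inj' h3 rfl).2
      subst hd
      exact key (h1.subset (by simp)) (h2.subset (by simp))

/-! ### Removing the first entry -/

/-- Entries of `w` below `v` increase across each entry above `v`: this excludes the occurrences
of 3241 in `v :: w` that start at `v`. -/
def AscAcross (v : ℕ) (w : List ℕ) : Prop :=
  ∀ s r s' : ℕ, [s, r, s'].Sublist w → s < v → v < r → s' < v → s < s'

/-- The entries of `w` below `v`. -/
def smalls (v : ℕ) (w : List ℕ) : List ℕ := w.filter (· < v)

/-- The entries of `w` above `v`. -/
def larges (v : ℕ) (w : List ℕ) : List ℕ := w.filter (v < ·)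

theorem mem_smalls {v y : ℕ} {w : List ℕ} : y ∈ smalls v w ↔ y ∈ w ∧ y < v := by simp [smalls]

theorem mem_larges {v y : ℕ} {w : List ℕ} : y ∈ larges v w ↔ y ∈ w ∧ v < y := by simp [larges]

theorem smalls_append (v : ℕ) (w w' : List ℕ) :
    smalls v (w ++ w') = smalls v w ++ smalls v w' := List.filter_append ..

theorem larges_append (v : ℕ) (w w' : List ℕ) :
    larges v (w ++ w') = larges v w ++ larges v w' := List.filter_append ..

theorem smalls_eq_self {v : ℕ} {w : List ℕ} (h : ∀ y ∈ w, y < v) : smalls v w = w := by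
  simpa [smalls] using h

theorem larges_eq_self {v : ℕ} {w : List ℕ} (h : ∀ y ∈ w, v < y) : larges v w = w := by
  simpa [larges] using h

theorem smalls_eq_nil {v : ℕ} {w : List ℕ} (h : ∀ y ∈ w, v < y) : smalls v w = [] := by
  simp only [smalls, List.filter_eq_nil_iff, decide_eq_true_eq]
  exact fun y hy => (h y hy).asymm

theorem larges_eq_nil {v : ℕ} {w : List ℕ} (h : ∀ y ∈ w, y < v) : larges v w = [] := by
  simp only [larges, List.filter_eq_nil_iff, decide_eq_true_eq]
  exact fun y hy => (h y hy).asymm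

/-- An occurrence of 3241 in `v :: w` either starts at `v`, or lies among the smaller entries, or
among the larger ones, or has only its last entry below `v`; in all other cases an entry above `v`
separates two smaller ones that decrease, and together with `v` these form an occurrence. -/
theorem av3241_cons_iff {v : ℕ} {w : List ℕ} (hv : (v :: w).Nodup) :
    Av3241 (v :: w) ↔ AscAcross v w ∧ Av3241 (smalls v w) ∧ Av3241 (larges v w) ∧
      ∀ w₁ s w₂, w = w₁ ++ s :: w₂ → s < v → Av213 (larges v w₁) := by
  obtain ⟨hvw, hw⟩ := List.nodup_cons.1 hv
  constructor
  · intro h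
    refine ⟨fun s r s' hs h1 h2 h3 => ?_, h.sublist ?_, h.sublist ?_, ?_⟩
    · have hne : s ≠ s' := by
        have := hs.nodup hw
        simp at this; tauto
      by_contra hlt
      exact h v s r s' (hs.cons_cons v) ⟨by omega, h1, h2⟩
    · exact List.filter_sublist.trans (List.sublist_cons_self ..)
    · exact List.filter_sublist.trans (List.sublist_cons_self ..)
    · rintro w₁ s w₂ rfl hs a b c habc hlt
      have hb : v < b := (mem_larges.1 (habc.subset (by simp))).2
      refine h a b c s (List.Sublist.cons _ ?_) ⟨by omega, hlt⟩
      exact (habc.trans List.filter_sublist).append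
        (List.singleton_sublist.2 (List.mem_cons_self (a := s) (l := w₂)))
  · rintro ⟨ha, hs, hl, hc⟩ a b c d hsub ⟨h1, h2, h3⟩
    rcases List.sublist_cons_iff.1 hsub with hsub | ⟨r, he, hsub⟩
    · have hne : ∀ y ∈ [a, b, c, d], y ≠ v := fun y hy hyv => hvw (hyv ▸ hsub.subset hy)
      have ha' := hne a (by simp)
      have hb' := hne b (by simp)
      have hc' := hne c (by simp)
      have hd' := hne d (by simp)
      by_cases hdv : d < v
      · by_cases hcv : c < v
        · refine hs a b c d ?_ ⟨h1, h2, h3⟩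
          have := hsub.filter (· < v)
          rwa [List.filter_eq_self.2] at this
          simp; omega
        · by_cases hbv : b < v
          · have := ha b c d ((List.sublist_cons_self ..).trans hsub) hbv (by omega) hdv
            omega
          · obtain ⟨w₁, w₂, hw12, h4, h5⟩ :=
              List.append_sublist_iff.1 (show ([a, b, c] ++ [d]).Sublist w from hsub)
            obtain ⟨w₃, w₄, rfl⟩ := List.append_of_mem (List.singleton_sublist.1 h5)
            refine hc (w₁ ++ w₃) d w₄ (by simp [hw12]) hdv a b c ?_ ⟨h2, h3⟩
            have := (h4.trans (List.sublist_append_left w₁ w₃)).filter (v < ·)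
            rwa [List.filter_eq_self.2] at this
            simp; omega
      · refine hl a b c d ?_ ⟨h1, h2, h3⟩
        have := hsub.filter (v < ·)
        rwa [List.filter_eq_self.2] at this
        simp; omega
    · obtain ⟨rfl, rfl⟩ := List.cons.inj he
      have := ha b c d hsub h2 h3 (by omega)
      omega

theorem av213_cons_of_lt {v : ℕ} {C : List ℕ} (hC : Av213 C) (hv : ∀ y ∈ C, v < y) :
    Av213 (v :: C) := by
  intro a b c hs hp
  rcases List.sublist_cons_iff.1 hs with hs | ⟨r, he, hs⟩
  · exact hC a b c hs hp
  · obtain ⟨rfl, rfl⟩ := List.cons.inj he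
    have := hv b (hs.subset (by simp))
    omega

/-- A skew sum avoids the skew-indecomposable pattern 213 as soon as both summands do. -/
theorem Av213.append_of_gt {A B : List ℕ} (hA : Av213 A) (hB : Av213 B)
    (hgt : ∀ y ∈ A, ∀ z ∈ B, z < y) : Av213 (A ++ B) := by
  intro a b c hs hp
  obtain ⟨l₁, l₂, he, h1, h2⟩ := List.sublist_append_iff.1 hs
  rcases l₁ with _ | ⟨a', l₁⟩
  · exact hB a b c (by simpa [he] using h2) hp
  · obtain ⟨rfl, he⟩ := List.cons.inj he
    rcases List.eq_nil_or_concat l₂ with rfl | ⟨l₃, c', rfl⟩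
    · exact hA a b c (by simpa [he] using h1) hp
    · have hc : c = c' := by
        have h3 : [b] ++ [c] = (l₁ ++ l₃) ++ [c'] := by simpa using he
        simpa using (List.append_inj' h3 rfl).2
      subst hc
      have := hgt a (h1.subset (by simp)) c (h2.subset (by simp))
      omega

theorem free_cons_of_lt {v : ℕ} {C : List ℕ} (hv : ∀ y ∈ C, v < y) :
    free (v :: C) = free C + 1 := by
  refine eq_of_forall_le_iff fun k => ?_
  rcases k with _ | k
  · simp
  · rw [Nat.succ_le_succ_iff, le_free_iff, le_free_iff, List.length_cons, Nat.succ_le_succ_iff,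
      List.take_succ_cons]
    refine and_congr_right fun _ => ⟨fun h => h.sublist (List.sublist_cons_self ..), fun h => ?_⟩
    exact av213_cons_of_lt h fun y hy => hv y (List.mem_of_mem_take hy)

/-- If `l` starts with a 213-avoiding part `A` followed by a nonempty block `B` below it, after
which an entry larger than some entry of `A` follows (if any), then the longest 213-avoiding
prefix ends within `B`. -/
theorem free_append_of_gt {A B D : List ℕ} (hA : Av213 A) (hgt : ∀ y ∈ A, ∀ z ∈ B, z < y)
    (hB : B ≠ []) (hD : D = [] ∨ ∃ r D', D = r :: D' ∧ ∃ a ∈ A, a < r) :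
    free (A ++ (B ++ D)) = A.length + free B := by
  refine eq_of_forall_le_iff fun k => ?_
  rcases le_total k A.length with hk | hk
  · refine iff_of_true (le_free_iff.2 ⟨by simp; omega, ?_⟩) (by omega)
    rw [List.take_append_of_le_length hk]
    exact hA.sublist (List.take_sublist ..)
  · obtain ⟨m, rfl⟩ := Nat.exists_eq_add_of_le hk
    rw [Nat.add_le_add_iff_left, le_free_iff, le_free_iff, List.take_length_add_append]
    rcases le_or_gt m B.length with hm | hm
    · rw [List.take_append_of_le_length hm]
      refine and_congr (by simp; omega) ⟨fun h => h.sublist (List.sublist_append_right ..),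
        fun h => hA.append_of_gt h fun y hy z hz => hgt y hy z (List.mem_of_mem_take hz)⟩
    · refine iff_of_false (fun h => ?_) (by omega)
      obtain ⟨h1, h2⟩ := h
      rcases hD with rfl | ⟨r, D', rfl, a, ha, har⟩
      · simp at h1; omega
      · obtain ⟨b, hb⟩ := List.exists_mem_of_ne_nil _ hB
        obtain ⟨j, rfl⟩ := Nat.exists_eq_add_of_lt hm
        have h3 : B.length + j + 1 = B.length + (j + 1) := by omega
        rw [h3, List.take_length_add_append, List.take_succ_cons] at h2
        have h4 : [b, r].Sublist (B ++ r :: D'.take j) :=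
          (List.singleton_sublist.2 hb).append (by simp : [r].Sublist (r :: D'.take j))
        exact h2 a b r ((List.singleton_sublist.2 ha).append h4) ⟨hgt a ha b hb, har⟩

theorem perm_smalls_larges {v : ℕ} {w : List ℕ} (hv : v ∉ w) :
    (smalls v w ++ larges v w).Perm w := by
  have h : larges v w = w.filter (fun y => !decide (y < v)) := by
    apply List.filter_congr
    intro y hy
    have : y ≠ v := fun h => hv (h ▸ hy)
    rw [← decide_not, decide_eq_decide]
    omega
  rw [h]
  exact List.filter_append_perm _ w

/-- `w` is a shuffle of an arrangement of `[o, o + i)`, whose entries lie below `v`, with the list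
`R` of entries above `v`, such that the lower entries avoid 3241, increase across each entry of
`R`, and all come before the entry number `e` of `R`, counted from `0`. -/
structure Shuf (v o i e : ℕ) (R w : List ℕ) : Prop where
  fills : Fills o i (smalls v w)
  larges_eq : larges v w = R
  notMem : v ∉ w
  asc : AscAcross v w
  av : Av3241 (smalls v w)
  within : ∀ w₁ s w₂, w = w₁ ++ s :: w₂ → s < v → (larges v w₁).length ≤ e

theorem exists_split {v : ℕ} {w : List ℕ} (hv : v ∉ w) :
    ∃ B D, w = B ++ D ∧ (∀ y ∈ B, y < v) ∧ (D = [] ∨ ∃ r D', D = r :: D' ∧ v < r) := by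
  induction w with
  | nil => exact ⟨[], [], rfl, by simp, Or.inl rfl⟩
  | cons y w ih =>
    rw [List.mem_cons, not_or] at hv
    rcases lt_or_gt_of_ne hv.1 with h | h
    · exact ⟨[], y :: w, rfl, by simp, Or.inr ⟨y, w, rfl, h⟩⟩
    · obtain ⟨B, D, rfl, h1, h2⟩ := ih hv.2
      exact ⟨y :: B, D, rfl, by simpa using ⟨h, h1⟩, h2⟩

/-- Splitting off the leading smaller entries `B` together with the first larger entry `r`. -/
theorem ascAcross_append_cons {v r : ℕ} {B w : List ℕ} (hB : ∀ y ∈ B, y < v) (hr : v < r) :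
    AscAcross v (B ++ r :: w) ↔
      AscAcross v w ∧ ∀ s ∈ B, ∀ s' ∈ smalls v w, s < s' := by
  constructor
  · intro h
    refine ⟨fun s x s' hs => h s x s' ?_, fun s hs s' hs' => ?_⟩
    · exact (hs.trans (List.sublist_cons_self ..)).trans (List.sublist_append_right ..)
    · rw [mem_smalls] at hs'
      refine h s r s' ?_ (hB s hs) hr hs'.2
      exact (List.singleton_sublist.2 hs).append
        ((List.singleton_sublist.2 hs'.1).cons_cons r)
  · rintro ⟨h1, h2⟩ s x s' hs hsv hx hsv'
    obtain ⟨l₁, l₂, he, h3, h4⟩ := List.sublist_append_iff.1 hs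
    rcases l₁ with _ | ⟨a, _ | ⟨b, l₁⟩⟩
    · rw [List.nil_append] at he
      subst he
      rcases List.sublist_cons_iff.1 h4 with h4 | ⟨r, he, h4⟩
      · exact h1 s x s' h4 hsv hx hsv'
      · obtain ⟨rfl, rfl⟩ := List.cons.inj he
        omega
    · simp only [List.cons_append, List.nil_append, List.cons.injEq] at he
      obtain ⟨rfl, rfl⟩ := he
      have h5 : s' ∈ r :: w := h4.subset (by simp)
      rcases List.mem_cons.1 h5 with rfl | h5
      · omega
      · exact h2 s (h3.subset (by simp)) s' (mem_smalls.2 ⟨h5, hsv'⟩)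
    · simp only [List.cons_append, List.cons.injEq] at he
      obtain ⟨rfl, rfl, _⟩ := he
      have := hB x (h3.subset (by simp))
      omega

theorem shuf_zero {v o i : ℕ} {R w : List ℕ} (hR : ∀ y ∈ R, v < y) (hv : o + i ≤ v) :
    Shuf v o i 0 R w ↔ ∃ B ∈ avoiders o i, w = B ++ R := by
  constructor
  · intro h
    obtain ⟨B, D, rfl, hB, hD⟩ := exists_split h.notMem
    have hDl : ∀ y ∈ D, v < y := by
      rcases hD with rfl | ⟨r, D', rfl, hr⟩
      · simp
      · intro y hy
        rcases List.mem_cons.1 hy with rfl | hy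
        · exact hr
        · have hne : y ≠ v := fun hyv => h.notMem (by simp [← hyv, hy])
          by_contra hlt
          obtain ⟨w₁, w₂, rfl⟩ := List.append_of_mem hy
          have := h.within (B ++ r :: w₁) y w₂ (by simp) (by omega)
          simp [larges, hr] at this
    have hs : smalls v (B ++ D) = B := by
      rw [smalls_append, smalls_eq_self hB, smalls_eq_nil hDl, List.append_nil]
    have hl : larges v (B ++ D) = D := by
      rw [larges_append, larges_eq_nil hB, larges_eq_self hDl, List.nil_append]
    refine ⟨B, mem_avoiders.2 ⟨hs ▸ h.fills, hs ▸ h.av⟩, ?_⟩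
    rw [← h.larges_eq, hl]
  · rintro ⟨B, hB, rfl⟩
    obtain ⟨hf, ha⟩ := mem_avoiders.1 hB
    have hBv : ∀ y ∈ B, y < v := fun y hy => by have := (hf.2 y).1 hy; omega
    have hs : smalls v (B ++ R) = B := by
      rw [smalls_append, smalls_eq_self hBv, smalls_eq_nil hR, List.append_nil]
    have hl : larges v (B ++ R) = R := by
      rw [larges_append, larges_eq_nil hBv, larges_eq_self hR, List.nil_append]
    refine ⟨hs.symm ▸ hf, hl, ?_, ?_, hs.symm ▸ ha, ?_⟩
    · intro h
      rcases List.mem_append.1 h with h | h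
      · exact (hBv v h).false
      · exact (hR v h).false
    · intro s r s' hsub h1 h2 h3
      obtain ⟨l₁, l₂, he, h4, h5⟩ := List.sublist_append_iff.1 hsub
      rcases List.eq_nil_or_concat l₂ with rfl | ⟨l₃, d, rfl⟩
      · rw [List.append_nil] at he
        subst he
        have := hBv r (h4.subset (by simp)); omega
      · have h6 : [s, r] ++ [s'] = (l₁ ++ l₃) ++ [d] := by simpa using he
        have h7 : s' = d := by simpa using (List.append_inj' h6 rfl).2
        have := hR d (h5.subset (by simp)); omega
    · intro w₁ s w₂ he hsv
      rcases List.append_eq_append_iff.1 he with ⟨a, rfl, h2⟩ | ⟨a, h1, h2⟩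
      · have := hR s (by rw [h2]; simp); omega
      · have : larges v w₁ = [] := larges_eq_nil fun y hy => hBv y (by rw [h1]; simp [hy])
        simp [this]

theorem shuf_succ {v o i e r : ℕ} {R w : List ℕ} (hR : ∀ y ∈ r :: R, v < y) (hv : o + i ≤ v) :
    Shuf v o i (e + 1) (r :: R) w ↔ ∃ b c, b + c = i ∧ ∃ B ∈ avoiders o b,
      ∃ w', Shuf v (o + b) c e R w' ∧ w = B ++ r :: w' := by
  have hr : v < r := hR r (by simp)
  have hsm : ∀ B w' : List ℕ, (∀ y ∈ B, y < v) →
      smalls v (B ++ r :: w') = B ++ smalls v w' := by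
    intro B w' hB
    rw [smalls_append, smalls_eq_self hB]
    simp [smalls, hr.le]
  have hlm : ∀ B w' : List ℕ, (∀ y ∈ B, y < v) →
      larges v (B ++ r :: w') = r :: larges v w' := by
    intro B w' hB
    rw [larges_append, larges_eq_nil hB]
    simp [larges, hr]
  constructor
  · intro h
    obtain ⟨B, D, rfl, hB, hD⟩ := exists_split h.notMem
    rcases hD with rfl | ⟨x, w', rfl, hx⟩
    · have := h.larges_eq
      rw [List.append_nil, larges_eq_nil hB] at this
      simp at this
    have hxr : x = r := by
      have := h.larges_eq
      rw [larges_append, larges_eq_nil hB] at this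
      simp only [larges, hx, List.filter_cons, decide_true, if_true, List.nil_append,
        List.cons.injEq] at this
      exact this.1
    subst hxr
    obtain ⟨ha1, ha2⟩ := (ascAcross_append_cons hB hx).1 h.asc
    have hf := h.fills
    rw [hsm B w' hB] at hf
    obtain ⟨c, hc, hfB, hfw⟩ := hf.of_append ha2
    have hav := h.av
    rw [hsm B w' hB] at hav
    refine ⟨B.length, c, hc, B, mem_avoiders.2 ⟨hfB, hav.sublist (List.sublist_append_left ..)⟩,
      w', ⟨hfw, ?_, fun hm => h.notMem (by simp [hm]), ha1,
        hav.sublist (List.sublist_append_right ..), ?_⟩, rfl⟩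
    · have := h.larges_eq
      rw [hlm B w' hB] at this
      exact (List.cons.inj this).2
    · rintro w₁ s w₂ rfl hs
      have := h.within (B ++ x :: w₁) s w₂ (by simp) hs
      rw [hlm B w₁ hB, List.length_cons] at this
      omega
  · rintro ⟨b, c, rfl, B, hB, w', h, rfl⟩
    obtain ⟨hf, ha⟩ := mem_avoiders.1 hB
    have hBv : ∀ y ∈ B, y < v := fun y hy => by have := (hf.2 y).1 hy; omega
    have hlt : ∀ s ∈ B, ∀ s' ∈ smalls v w', s < s' := fun s hs s' hs' => by
      have := (hf.2 s).1 hs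
      have := (h.fills.2 s').1 hs'
      omega
    refine ⟨?_, ?_, ?_, (ascAcross_append_cons hBv hr).2 ⟨h.asc, hlt⟩, ?_, ?_⟩
    · rw [hsm B w' hBv]; exact hf.append h.fills
    · rw [hlm B w' hBv, h.larges_eq]
    · intro hm
      rcases List.mem_append.1 hm with hm | hm
      · exact (hBv v hm).false
      · rcases List.mem_cons.1 hm with rfl | hm
        · exact hr.false
        · exact h.notMem hm
    · rw [hsm B w' hBv]; exact ha.append h.av hlt
    · intro w₁ s w₂ he hsv
      rcases List.append_eq_append_iff.1 he with ⟨a, rfl, h2⟩ | ⟨a, h1, h2⟩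
      · rcases a with _ | ⟨y, a⟩
        · simp only [List.nil_append, List.cons.injEq] at h2
          omega
        · simp only [List.cons_append, List.cons.injEq] at h2
          obtain ⟨rfl, rfl⟩ := h2
          rw [hlm B a hBv, List.length_cons]
          have := h.within a s w₂ rfl hsv
          omega
      · have : larges v w₁ = [] := larges_eq_nil fun y hy => hBv y (by rw [h1]; simp [hy])
        simp [this]

/-- Removing the first entry `o + i` of a 3241-avoiding arrangement: the larger entries form an
arbitrary avoider `R`, and the smaller ones are shuffled into the part of `R` that ends with its
longest 213-avoiding prefix. -/
theorem mem_avoiders_succ {o n : ℕ} {l : List ℕ} :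
    l ∈ avoiders o (n + 1) ↔ ∃ i j, i + j = n ∧ ∃ R ∈ avoiders (o + i + 1) j,
      ∃ w, Shuf (o + i) o i (free R) R w ∧ l = (o + i) :: w := by
  constructor
  · intro h
    obtain ⟨hf, ha⟩ := mem_avoiders.1 h
    obtain ⟨v, w, rfl⟩ := List.exists_cons_of_length_eq_add_one hf.length
    have hv := (hf.2 v).1 (by simp)
    obtain ⟨i, rfl⟩ := Nat.exists_eq_add_of_le hv.1
    obtain ⟨hvw, hw⟩ := List.nodup_cons.1 hf.1
    obtain ⟨h1, h2, h3, h4⟩ := (av3241_cons_iff hf.1).1 ha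
    have hmem : ∀ y, y ≠ o + i → (y ∈ w ↔ o ≤ y ∧ y < o + (n + 1)) := fun y hy => by
      rw [← hf.2 y, List.mem_cons]; simp [hy]
    refine ⟨i, n - i, by omega, larges (o + i) w, mem_avoiders.2 ⟨⟨hw.filter _, fun y => ?_⟩, h3⟩,
      w, ⟨⟨hw.filter _, fun y => ?_⟩, rfl, hvw, h1, h2, ?_⟩, rfl⟩
    · rw [mem_larges]
      by_cases hy : y = o + i
      · omega
      · rw [hmem y hy]; omega
    · rw [mem_smalls]
      by_cases hy : y = o + i
      · omega
      · rw [hmem y hy]; omega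
    · rintro w₁ s w₂ rfl hs
      rw [le_free_iff, larges_append, List.take_left']
      · exact ⟨by simp, h4 w₁ s w₂ rfl hs⟩
      · rfl
  · rintro ⟨i, j, rfl, R, hR, w, h, rfl⟩
    obtain ⟨hf, ha⟩ := mem_avoiders.1 hR
    have hfill : Fills o (i + j + 1) ((o + i) :: w) := by
      have h1 : Fills (o + i) 1 [o + i] := ⟨by simp, fun y => by simp; omega⟩
      have h2 := h.fills.append (h1.append hf)
      rw [show i + j + 1 = i + (1 + j) by omega]
      rw [fills_iff_perm] at h2 ⊢
      refine List.Perm.trans ?_ h2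
      refine List.Perm.trans ?_ List.perm_middle.symm
      refine List.Perm.cons _ ?_
      have := (perm_smalls_larges h.notMem).symm
      rwa [h.larges_eq] at this
    refine mem_avoiders.2 ⟨hfill, (av3241_cons_iff hfill.1).2 ⟨h.asc, h.av,
      h.larges_eq.symm ▸ ha, ?_⟩⟩
    rintro w₁ s w₂ rfl hs
    have h1 := h.within w₁ s w₂ rfl hs
    have h2 := h.larges_eq
    rw [larges_append] at h2
    have h3 := (le_free_iff.1 h1).2
    rwa [← h2, List.take_left' rfl] at h3

/-! ### Summation over avoiders -/

theorem map_add_sublist_iff {o : ℕ} {p l : List ℕ} :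
    (p.map (o + ·)).Sublist (l.map (o + ·)) ↔ p.Sublist l := by
  constructor
  · intro h
    have := h.map (· - o)
    simpa [Function.comp_def] using this
  · exact fun h => h.map _

theorem exists_map_of_sublist_map {o : ℕ} {p l : List ℕ} (h : p.Sublist (l.map (o + ·))) :
    p = (p.map (· - o)).map (o + ·) := by
  rw [List.map_map]
  symm
  conv_rhs => rw [← List.map_id p]
  refine List.map_congr_left fun y hy => ?_
  obtain ⟨z, _, rfl⟩ := List.mem_map.1 (h.subset hy)
  simp

theorem av213_map_add {o : ℕ} {l : List ℕ} : Av213 (l.map (o + ·)) ↔ Av213 l := by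
  constructor
  · intro h a b c hs hp
    exact h (o + a) (o + b) (o + c) (map_add_sublist_iff.2 hs) (by omega)
  · intro h a b c hs hp
    have he := exists_map_of_sublist_map hs
    rw [he, map_add_sublist_iff] at hs
    simp only [List.map_cons, List.map_nil, List.cons.injEq, and_true] at he
    exact h (a - o) (b - o) (c - o) hs (by omega)

theorem av3241_map_add {o : ℕ} {l : List ℕ} : Av3241 (l.map (o + ·)) ↔ Av3241 l := by
  constructor
  · intro h a b c d hs hp
    exact h (o + a) (o + b) (o + c) (o + d) (map_add_sublist_iff.2 hs) (by omega)
  · intro h a b c d hs hp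
    have he := exists_map_of_sublist_map hs
    rw [he, map_add_sublist_iff] at hs
    simp only [List.map_cons, List.map_nil, List.cons.injEq, and_true] at he
    exact h (a - o) (b - o) (c - o) (d - o) hs (by omega)

theorem free_map_add (o : ℕ) (l : List ℕ) : free (l.map (o + ·)) = free l := by
  refine eq_of_forall_le_iff fun k => ?_
  rw [le_free_iff, le_free_iff, List.length_map, ← List.map_take, av213_map_add]

theorem fills_map_add {o n : ℕ} {l : List ℕ} : Fills o n (l.map (o + ·)) ↔ Fills 0 n l := by
  have hinj : Function.Injective (o + ·) := add_right_injective o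
  refine and_congr (List.nodup_map_iff hinj) ⟨fun h y => ?_, fun h y => ?_⟩
  · rw [← List.mem_map_of_injective hinj (l := l), h]; omega
  · rw [List.mem_map]
    constructor
    · rintro ⟨z, hz, rfl⟩
      have := (h z).1 hz; omega
    · intro hy
      exact ⟨y - o, (h _).2 (by omega), by omega⟩

/-- The distribution of `free` over the avoiders does not depend on the interval they arrange. -/
theorem sum_avoiders_shift {M : Type*} [AddCommMonoid M] (o n : ℕ) (wt : ℕ → M) :
    ∑ l ∈ avoiders o n, wt (free l) = ∑ l ∈ avoiders 0 n, wt (free l) := by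
  symm
  refine Finset.sum_bij (fun l _ => l.map (o + ·)) (fun l hl => ?_) (fun l _ l' _ h => ?_)
    (fun l hl => ?_) (fun l _ => by rw [free_map_add])
  · rw [mem_avoiders] at hl ⊢
    rwa [fills_map_add, av3241_map_add]
  · exact List.map_injective_iff.2 (add_right_injective o) h
  · have he : l = (l.map (· - o)).map (o + ·) := by
      rw [List.map_map]
      conv_lhs => rw [← List.map_id l]
      refine List.map_congr_left fun y hy => ?_
      have := (((mem_avoiders.1 hl).1).2 y).1 hy
      simp; omega
    refine ⟨l.map (· - o), ?_, he.symm⟩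
    rw [mem_avoiders] at hl ⊢
    rwa [he, fills_map_add, av3241_map_add] at hl

open Classical in
/-- The finite set of the shuffles described by `Shuf`. -/
noncomputable def shuffles (v o i e : ℕ) (R : List ℕ) : Finset (List ℕ) :=
  (List.range' o i ++ R).permutations.toFinset.filter (Shuf v o i e R)

theorem mem_shuffles {v o i e : ℕ} {R w : List ℕ} :
    w ∈ shuffles v o i e R ↔ Shuf v o i e R w := by
  classical
  simp only [shuffles, Finset.mem_filter, List.mem_toFinset, List.mem_permutations,
    and_iff_right_iff_imp]
  intro h
  refine (perm_smalls_larges h.notMem).symm.trans ?_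
  rw [h.larges_eq]
  exact (fills_iff_perm.1 h.fills).append_right R

theorem sum_eq_sum_of_decomposition {α β M : Type*} [AddCommMonoid M] {s : Finset α}
    {t : Finset β} (g : β → α) (hg : Set.InjOn g t) (h : ∀ a, a ∈ s ↔ ∃ b ∈ t, a = g b)
    (wt : α → M) : ∑ a ∈ s, wt a = ∑ b ∈ t, wt (g b) := by
  symm
  refine Finset.sum_bij (fun b _ => g b) (fun b hb => (h _).2 ⟨b, hb, rfl⟩)
    (fun b hb b' hb' e => hg hb hb' e) (fun a ha => ?_) (fun _ _ => rfl)
  obtain ⟨b, hb, rfl⟩ := (h a).1 ha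
  exact ⟨b, hb, rfl⟩

/-- Sums over shuffles, split along the blocks of smaller entries: the last block. -/
theorem sum_shuffles_zero {M : Type*} [AddCommMonoid M] {v o i : ℕ} {R : List ℕ}
    (hR : ∀ y ∈ R, v < y) (hv : o + i ≤ v) (wt : List ℕ → M) :
    ∑ w ∈ shuffles v o i 0 R, wt w = ∑ B ∈ avoiders o i, wt (B ++ R) :=
  sum_eq_sum_of_decomposition (fun B => B ++ R) (fun _ _ _ _ h => List.append_cancel_right h)
    (fun w => by rw [mem_shuffles, shuf_zero hR hv]) wt

theorem append_cons_inj_of_lt {v r : ℕ} (hr : v < r) {B B' w w' : List ℕ} (hB : ∀ y ∈ B, y < v)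
    (hB' : ∀ y ∈ B', y < v) (h : B ++ r :: w = B' ++ r :: w') : B = B' ∧ w = w' := by
  induction B generalizing B' with
  | nil =>
    rcases B' with _ | ⟨y, B'⟩
    · simpa using h
    · have := hB' y (by simp)
      simp only [List.nil_append, List.cons_append, List.cons.injEq] at h
      omega
  | cons x B ih =>
    rcases B' with _ | ⟨y, B'⟩
    · have := hB x (by simp)
      simp only [List.nil_append, List.cons_append, List.cons.injEq] at h
      omega
    · simp only [List.cons_append, List.cons.injEq] at h
      obtain ⟨rfl, h⟩ := h
      have := ih (fun y hy => hB y (by simp [hy])) (fun y hy => hB' y (by simp [hy])) h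
      simpa using this

/-- Sums over shuffles, split along the blocks of smaller entries: the block in front of the first
larger entry `r`. -/
theorem sum_shuffles_succ {M : Type*} [AddCommMonoid M] {v o i e r : ℕ} {R : List ℕ}
    (hR : ∀ y ∈ r :: R, v < y) (hv : o + i ≤ v) (wt : List ℕ → M) :
    ∑ w ∈ shuffles v o i (e + 1) (r :: R), wt w =
      ∑ x ∈ antidiagonal i, ∑ B ∈ avoiders o x.1,
        ∑ w ∈ shuffles v (o + x.1) x.2 e R, wt (B ++ r :: w) := by
  simp_rw [Finset.sum_sigma']
  refine sum_eq_sum_of_decomposition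
    (fun z : (Σ _ : ℕ × ℕ, Σ _ : List ℕ, List ℕ) => z.2.1 ++ r :: z.2.2) ?_ (fun w => ?_) wt
  · rintro ⟨⟨b, c⟩, B, w⟩ h1 ⟨⟨b', c'⟩, B', w'⟩ h2 h
    simp only [Finset.coe_sigma, Set.mem_sigma_iff, Finset.mem_coe, mem_antidiagonal,
      mem_avoiders] at h1 h2
    have hBv : ∀ y ∈ B, y < v := fun y hy => by have := (h1.2.1.1.2 y).1 hy; omega
    have hBv' : ∀ y ∈ B', y < v := fun y hy => by have := (h2.2.1.1.2 y).1 hy; omega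
    have hl := h1.2.1.1.length
    have hl' := h2.2.1.1.length
    obtain ⟨h1, _, _⟩ := h1
    obtain ⟨h2, _, _⟩ := h2
    obtain ⟨rfl, rfl⟩ := append_cons_inj_of_lt (hR r (by simp)) hBv hBv' h
    obtain rfl : b = b' := by omega
    obtain rfl : c = c' := by omega
    rfl
  · rw [mem_shuffles, shuf_succ hR hv]
    simp only [Finset.mem_sigma, mem_antidiagonal, mem_shuffles]
    constructor
    · rintro ⟨b, c, h, B, hB, w', hw', rfl⟩
      exact ⟨⟨(b, c), B, w'⟩, ⟨h, hB, hw'⟩, rfl⟩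
    · rintro ⟨⟨⟨b, c⟩, B, w'⟩, ⟨h, hB, hw'⟩, rfl⟩
      exact ⟨b, c, h, B, hB, w', hw', rfl⟩

theorem sum_avoiders_succ {M : Type*} [AddCommMonoid M] (o n : ℕ) (wt : List ℕ → M) :
    ∑ l ∈ avoiders o (n + 1), wt l =
      ∑ x ∈ antidiagonal n, ∑ R ∈ avoiders (o + x.1 + 1) x.2,
        ∑ w ∈ shuffles (o + x.1) o x.1 (free R) R, wt ((o + x.1) :: w) := by
  simp_rw [Finset.sum_sigma']
  refine sum_eq_sum_of_decomposition
    (fun z : (Σ _ : ℕ × ℕ, Σ _ : List ℕ, List ℕ) => (o + z.1.1) :: z.2.2) ?_ (fun w => ?_) wt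
  · rintro ⟨⟨i, j⟩, R, w⟩ h1 ⟨⟨i', j'⟩, R', w'⟩ h2 h
    simp only [Finset.coe_sigma, Set.mem_sigma_iff, Finset.mem_coe, mem_antidiagonal,
      mem_shuffles] at h1 h2
    simp only [List.cons.injEq, Nat.add_left_cancel_iff] at h
    obtain ⟨rfl, rfl⟩ := h
    obtain rfl : j = j' := by omega
    obtain rfl : R = R' := by rw [← h1.2.2.larges_eq, h2.2.2.larges_eq]
    rfl
  · rw [mem_avoiders_succ]
    simp only [Finset.mem_sigma, mem_antidiagonal, mem_shuffles]
    constructor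
    · rintro ⟨i, j, h, R, hR, w', hw', rfl⟩
      exact ⟨⟨(i, j), R, w'⟩, ⟨h, hR, hw'⟩, rfl⟩
    · rintro ⟨⟨⟨i, j⟩, R, w'⟩, ⟨h, hR, hw'⟩, rfl⟩
      exact ⟨i, j, h, R, hR, w', hw', rfl⟩

/-! ### The functional equation -/

section GeneratingFunctions

variable {S : Type*} [CommRing S]

/-- The generating function of the 3241-avoiding arrangements by length, with weight `u` for
each unit of `free`. -/
noncomputable def Y (u : S) : S⟦X⟧ :=
  PowerSeries.mk fun n => ∑ l ∈ avoiders 0 n, u ^ free l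

/-- The generating function, by the number of smaller entries, of the shuffles of smaller entries
into a list of larger entries `R` with `free R = e`, weighted by the value of `free` after the
separating entry has been put in front (without its own contribution). -/
noncomputable def K (u : S) : ℕ → S⟦X⟧
  | 0 => Y u
  | e + 1 => PowerSeries.C u * K u e + (Y u - 1) * Y 1 ^ (e + 1)

/-- The interval that the avoiders arrange may start anywhere. -/
theorem coeff_Y (u : S) (o n : ℕ) :
    ∑ l ∈ avoiders o n, u ^ free l = PowerSeries.coeff n (Y u) := by
  rw [Y, PowerSeries.coeff_mk, sum_avoiders_shift o n fun k => u ^ k]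

theorem coeff_zero_Y (u : S) : PowerSeries.coeff 0 (Y u) = 1 := by
  rw [← coeff_Y u 0, avoiders_zero]; simp [free_nil]

/-- At `u = 1` only the `e + 1` independent blocks are counted. -/
theorem K_one (e : ℕ) : K (1 : S) e = Y 1 ^ (e + 1) := by
  induction e with
  | zero => simp [K]
  | succ e ih => rw [K, ih, map_one]; ring

/-- A shuffle consists of `e + 1` independent avoiders. -/
theorem card_shuffles {v o i e : ℕ} {R : List ℕ} (hR : ∀ y ∈ R, v < y) (hv : o + i ≤ v)
    (he : e ≤ R.length) :
    ((shuffles v o i e R).card : S) = PowerSeries.coeff i (Y (1 : S) ^ (e + 1)) := by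
  have hcard : ∀ o n, ((avoiders o n).card : S) = PowerSeries.coeff n (Y (1 : S)) := fun o n => by
    rw [← coeff_Y 1 o]; simp
  have h1 : ∀ s : Finset (List ℕ), (s.card : S) = ∑ w ∈ s, (fun _ => (1 : S)) w := by simp
  induction e generalizing o i R with
  | zero =>
    rw [h1, sum_shuffles_zero hR hv, ← h1, hcard, zero_add, pow_one]
  | succ e ih =>
    obtain ⟨r, R, rfl⟩ := List.exists_cons_of_length_pos (by omega : 0 < R.length)
    rw [h1, sum_shuffles_succ hR hv, pow_succ', PowerSeries.coeff_mul]
    refine Finset.sum_congr rfl fun x hx => ?_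
    rw [mem_antidiagonal] at hx
    rw [← hcard o, Finset.cast_card, Finset.sum_mul]
    refine Finset.sum_congr rfl fun B _ => ?_
    rw [one_mul, ← h1, ih (fun y hy => hR y (by simp [hy])) (by omega) (by simpa using he)]

/-- The weighted count of the shuffles that arise when the blocks in front of the initial larger
entries `C` are empty; the induction moves entries from `R` to `C`. -/
theorem sum_shuffles_pow_free (u : S) {v o i e : ℕ} {C R : List ℕ} (hv : o + i ≤ v)
    (hC : ∀ y ∈ C, v < y) (hR : ∀ y ∈ R, v < y) (he : free (C ++ R) = C.length + e) :
    ∑ w ∈ shuffles v o i e R, u ^ free (v :: (C ++ w)) =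
      u ^ (C.length + 1) * PowerSeries.coeff i (K u e) := by
  have hCav : Av213 C := by
    have := (le_free_iff.1 (he.symm ▸ Nat.le_add_right _ _ : C.length ≤ free (C ++ R))).2
    rwa [List.take_left' rfl] at this
  have hA : Av213 (v :: C) := av213_cons_of_lt hCav hC
  have hblock : ∀ B D : List ℕ, B ≠ [] → (∀ y ∈ B, y < v) →
      (D = [] ∨ ∃ r D', D = r :: D' ∧ v < r) →
      free (v :: (C ++ (B ++ D))) = C.length + 1 + free B := by
    intro B D hB hBv hD
    refine free_append_of_gt (A := v :: C) hA (fun y hy z hz => ?_) hB ?_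
    · have := hBv z hz
      rcases List.mem_cons.1 hy with rfl | hy
      · exact this
      · exact this.trans (hC y hy)
    · rcases hD with rfl | ⟨r, D', rfl, hr⟩
      · exact Or.inl rfl
      · exact Or.inr ⟨r, D', rfl, v, by simp, hr⟩
  have hlt : ∀ {b : ℕ}, b ≤ i → ∀ B ∈ avoiders o b, ∀ y ∈ B, y < v := fun hb B hB y hy => by
    have := ((mem_avoiders.1 hB).1.2 y).1 hy; omega
  induction e generalizing i o C R with
  | zero =>
    rw [sum_shuffles_zero hR hv, K, ← coeff_Y u o, Finset.mul_sum]
    refine Finset.sum_congr rfl fun B hB => ?_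
    rw [← pow_add]
    congr 1
    rcases eq_or_ne B [] with rfl | hne
    · rw [List.nil_append, free_cons_of_lt, he, free_nil]
      · intro y hy
        rcases List.mem_append.1 hy with hy | hy
        · exact hC y hy
        · exact hR y hy
    · refine hblock B R hne (hlt le_rfl B hB) ?_
      rcases R with _ | ⟨r, R⟩
      · exact Or.inl rfl
      · exact Or.inr ⟨r, R, rfl, hR r (by simp)⟩
  | succ e ih =>
    have hle := he ▸ free_le_length (C ++ R)
    rw [List.length_append] at hle
    obtain ⟨r, R, rfl⟩ := List.exists_cons_of_length_pos (by omega : 0 < R.length)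
    have hr : v < r := hR r (by simp)
    have hR' : ∀ y ∈ R, v < y := fun y hy => hR y (by simp [hy])
    -- The block in front of `r` is empty in the first summand and nonempty in the second.
    have hterm : ∀ x ∈ antidiagonal i,
        ∑ B ∈ avoiders o x.1, ∑ w ∈ shuffles v (o + x.1) x.2 e R,
          u ^ free (v :: (C ++ (B ++ r :: w))) =
        (if x = (0, i) then u ^ (C.length + 1) * (u * PowerSeries.coeff i (K u e)) else 0) +
          u ^ (C.length + 1) * (PowerSeries.coeff x.1 (Y u - 1) *
            PowerSeries.coeff x.2 (Y 1 ^ (e + 1))) := by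
      rintro ⟨b, c⟩ hx
      rw [mem_antidiagonal] at hx
      dsimp only at hx ⊢
      rcases Nat.eq_zero_or_pos b with rfl | hb
      · obtain rfl : c = i := by omega
        rw [avoiders_zero, Finset.sum_singleton, if_pos rfl, map_sub, coeff_zero_Y]
        have hCr : ∀ y ∈ C ++ [r], v < y := by
          intro y hy
          rcases List.mem_append.1 hy with hy | hy
          · exact hC y hy
          · rw [List.mem_singleton.1 hy]; exact hr
        have he' : free (C ++ [r] ++ R) = (C ++ [r]).length + e := by
          rw [List.append_assoc, List.singleton_append, he, List.length_append,
            List.length_singleton]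
          omega
        have hCrav : Av213 (C ++ [r]) := by
          have := (le_free_iff.1 (he'.symm ▸ Nat.le_add_right _ _ :
            (C ++ [r]).length ≤ free (C ++ [r] ++ R))).2
          rwa [List.take_left' rfl] at this
        have := ih (o := o) (C := C ++ [r]) hv hCr hR' he' hCrav
          (av213_cons_of_lt hCrav hCr) ?_ hlt
        · simp only [List.append_assoc, List.singleton_append, List.length_append,
            List.length_singleton] at this
          simp only [List.nil_append, add_zero, this]
          simp only [PowerSeries.coeff_zero_eq_constantCoeff, map_one, sub_self]
          ring
        · intro B D hB hBv hD
          refine free_append_of_gt (A := v :: (C ++ [r])) (av213_cons_of_lt hCrav hCr)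
            (fun y hy z hz => ?_) hB ?_
          · have := hBv z hz
            rcases List.mem_cons.1 hy with rfl | hy
            · exact this
            · exact this.trans (hCr y hy)
          · rcases hD with rfl | ⟨r, D', rfl, hr⟩
            · exact Or.inl rfl
            · exact Or.inr ⟨r, D', rfl, v, by simp, hr⟩
      · rw [if_neg (by simp; omega), zero_add, map_sub, PowerSeries.coeff_one, if_neg (by omega),
          sub_zero, ← coeff_Y u o, Finset.sum_mul, Finset.mul_sum]
        refine Finset.sum_congr rfl fun B hB => ?_
        have hne : B ≠ [] := by
          have := (mem_avoiders.1 hB).1.length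
          rintro rfl
          simp at this; omega
        rw [← card_shuffles (v := v) (o := o + b) hR' (by omega) (by simp at hle; omega),
          Finset.cast_card, Finset.mul_sum, Finset.mul_sum]
        refine Finset.sum_congr rfl fun w _ => ?_
        rw [hblock B (r :: w) hne (hlt (by omega) B hB) (Or.inr ⟨r, w, rfl, hr⟩), pow_add,
          mul_one]
    rw [sum_shuffles_succ hR hv, Finset.sum_congr rfl hterm, Finset.sum_add_distrib,
      Finset.sum_ite_eq', if_pos (by simp), ← Finset.mul_sum, ← PowerSeries.coeff_mul, K, map_add,
      PowerSeries.coeff_C_mul]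
    ring

/-- Substituting the inner variable for the outer one in a power series whose coefficients are
power series. -/
noncomputable def diag : S⟦X⟧⟦X⟧ →+* S⟦X⟧ where
  toFun f := PowerSeries.mk fun n =>
    ∑ x ∈ antidiagonal n, PowerSeries.coeff x.1 (PowerSeries.coeff x.2 f)
  map_zero' := by ext n; simp
  map_add' f g := by ext n; simp [Finset.sum_add_distrib]
  map_one' := by
    ext n
    rw [PowerSeries.coeff_mk, Finset.sum_eq_single (n, 0)]
    · simp
    · rintro ⟨a, b⟩ h hne
      rw [mem_antidiagonal] at h
      rw [PowerSeries.coeff_one, if_neg, map_zero]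
      rintro rfl
      exact hne (by simpa using h)
    · simp
  map_mul' f g := by
    ext n
    simp only [PowerSeries.coeff_mk, PowerSeries.coeff_mul, map_sum, Finset.sum_mul_sum,
      Finset.sum_sigma']
    refine Finset.sum_nbij'
      (fun z => ⟨(z.2.2.1 + z.2.1.1, z.2.2.2 + z.2.1.2), (z.2.2.1, z.2.1.1), (z.2.2.2, z.2.1.2)⟩)
      (fun z => ⟨(z.2.1.1 + z.2.2.1, z.2.1.2 + z.2.2.2), (z.2.1.2, z.2.2.2), (z.2.1.1, z.2.2.1)⟩)
      ?_ ?_ ?_ ?_ ?_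
    · rintro ⟨⟨a, b⟩, ⟨c, d⟩, ⟨p, q⟩⟩ h
      simp at h ⊢; omega
    · rintro ⟨⟨a, b⟩, ⟨c, d⟩, ⟨p, q⟩⟩ h
      simp at h ⊢; omega
    · rintro ⟨⟨a, b⟩, ⟨c, d⟩, ⟨p, q⟩⟩ h
      simp at h ⊢; omega
    · rintro ⟨⟨a, b⟩, ⟨c, d⟩, ⟨p, q⟩⟩ h
      simp at h ⊢; omega
    · rintro ⟨⟨a, b⟩, ⟨c, d⟩, ⟨p, q⟩⟩ h
      rfl

theorem coeff_diag (f : S⟦X⟧⟦X⟧) (n : ℕ) : PowerSeries.coeff n (diag f) =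
    ∑ x ∈ antidiagonal n, PowerSeries.coeff x.1 (PowerSeries.coeff x.2 f) := by
  simp only [diag, RingHom.coe_mk, MonoidHom.coe_mk, OneHom.coe_mk, PowerSeries.coeff_mk]

theorem diag_C (g : S⟦X⟧) : diag (PowerSeries.C g) = g := by
  ext n
  rw [coeff_diag, Finset.sum_eq_single (n, 0)]
  · simp
  · rintro ⟨a, b⟩ h hne
    rw [mem_antidiagonal] at h
    rw [PowerSeries.coeff_C, if_neg, map_zero]
    rintro rfl
    exact hne (by simpa using h)
  · simp

theorem diag_map_C (g : S⟦X⟧) : diag (PowerSeries.map PowerSeries.C g) = g := by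
  ext n
  rw [coeff_diag, Finset.sum_eq_single (0, n)]
  · simp
  · rintro ⟨a, b⟩ h hne
    rw [mem_antidiagonal] at h
    rw [PowerSeries.coeff_map, PowerSeries.coeff_C, if_neg]
    rintro rfl
    exact hne (by simpa using h)
  · simp

/-- The sum of `f (free R)` over all avoiders `R`, each weighted by `X` to its length. -/
noncomputable def sumFree (f : ℕ → S⟦X⟧) : S⟦X⟧ :=
  diag (PowerSeries.mk fun j => ∑ R ∈ avoiders 0 j, f (free R))

theorem sumFree_add (f g : ℕ → S⟦X⟧) :
    sumFree (fun e => f e + g e) = sumFree f + sumFree g := by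
  rw [sumFree, sumFree, sumFree, ← map_add]
  congr 1
  ext1 j
  simp [Finset.sum_add_distrib]

theorem sumFree_mul (g : S⟦X⟧) (f : ℕ → S⟦X⟧) :
    sumFree (fun e => g * f e) = g * sumFree f := by
  rw [sumFree, sumFree]
  conv_rhs => rw [← diag_C g]
  rw [← map_mul]
  congr 1
  ext1 j
  simp [Finset.mul_sum]

theorem sumFree_C_pow (u : S) : sumFree (fun e => PowerSeries.C u ^ e) = Y u := by
  rw [sumFree]
  conv_rhs => rw [← diag_map_C (Y u)]
  congr 1
  ext1 j
  simp [Y]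

/-- Removing the first entry of each nonempty avoider. -/
theorem Y_eq (u : S) : Y u = 1 + PowerSeries.X * (PowerSeries.C u * sumFree (K u)) := by
  ext n
  rcases n with _ | n
  · rw [coeff_zero_Y]; simp
  · rw [map_add, PowerSeries.coeff_succ_X_mul, PowerSeries.coeff_C_mul, sumFree, coeff_diag,
      ← coeff_Y u 0, sum_avoiders_succ, PowerSeries.coeff_one, if_neg (by omega), zero_add,
      Finset.mul_sum]
    refine Finset.sum_congr rfl fun x _ => ?_
    rw [PowerSeries.coeff_mk, map_sum,
      ← sum_avoiders_shift (0 + x.1 + 1) x.2 fun k => PowerSeries.coeff x.1 (K u k),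
      Finset.mul_sum]
    refine Finset.sum_congr rfl fun R hR => ?_
    have := sum_shuffles_pow_free u (v := 0 + x.1) (o := 0) (i := x.1) (e := free R) (C := [])
      (R := R) le_rfl (by simp)
      (fun y hy => by have := ((mem_avoiders.1 hR).1.2 y).1 hy; omega) (by simp)
    simpa using this

/-- The geometric sum behind `K`, cleared of its denominator. -/
theorem sub_mul_K (u : S) (e : ℕ) : (PowerSeries.C u - Y 1) * K u e =
    (PowerSeries.C u - Y 1) * PowerSeries.C u ^ e +
      (Y u - 1) * (PowerSeries.C u * PowerSeries.C u ^ e - Y 1 * Y 1 ^ e) := by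
  induction e with
  | zero => rw [K]; ring
  | succ e ih =>
    rw [K, mul_add, mul_left_comm, ih]; ring

/-- The functional equation: the catalytic variable is `u`, and the unknown `Y 1` is the
generating function of all avoiders. -/
theorem functional_equation (u : S) :
    PowerSeries.X * PowerSeries.C u ^ 2 * Y u ^ 2 -
      Y 1 * (PowerSeries.C u - 1 + PowerSeries.X * PowerSeries.C u) * Y u +
      Y 1 * (PowerSeries.C u - 1) = 0 := by
  set c : S⟦X⟧ := PowerSeries.C u with hc
  set h : S⟦X⟧ := Y 1 with hh
  have h1 : h = 1 + PowerSeries.X * (h * sumFree (fun e => h ^ e)) := by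
    conv_lhs => rw [hh, Y_eq 1, map_one, one_mul]
    have h2 : K (1 : S) = fun e => h * h ^ e := by
      funext e
      rw [K_one, pow_succ']
    rw [h2, sumFree_mul]
  have h2 : (c - h) * sumFree (K u) = (c - h) * Y u +
      (Y u - 1) * (c * Y u - h * sumFree (fun e => h ^ e)) := by
    have h3 : (fun e => (c - h) * K u e) = fun e => ((c - h) + (Y u - 1) * c) * c ^ e +
        -((Y u - 1) * h) * h ^ e := by
      funext e
      rw [sub_mul_K]; ring
    rw [← sumFree_mul, h3, sumFree_add, sumFree_mul, sumFree_mul, hc, sumFree_C_pow]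
    ring
  have h4 := Y_eq u
  rw [← hc] at h4
  linear_combination -(c - h) * h4 - PowerSeries.X * c * h2 - (Y u - 1) * c * h1

end GeneratingFunctions

/-! ### Solution by the quadratic method -/

section Solution

open PowerSeries (X C)

theorem eq_zero_of_forall_X_pow_dvd {f : ℚ⟦X⟧} (h : ∀ k : ℕ, X ^ k ∣ f) : f = 0 := by
  ext n
  rw [map_zero]
  exact PowerSeries.X_pow_dvd_iff.1 (h (n + 1)) n (Nat.lt_succ_self n)

/-- A map of formal power series that is contracting for the `X`-adic metric has a fixed point. -/
theorem exists_fixed_point (Φ : ℚ⟦X⟧ → ℚ⟦X⟧)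
    (hΦ : ∀ (k : ℕ) (V V' : ℚ⟦X⟧), X ^ k ∣ V - V' → X ^ (k + 1) ∣ Φ V - Φ V') :
    ∃ V, Φ V = V := by
  set a : ℕ → ℚ⟦X⟧ := fun n => Φ^[n] 0 with ha
  have hsucc : ∀ n, a (n + 1) = Φ (a n) := fun n => Function.iterate_succ_apply' Φ n 0
  have h1 : ∀ n m, X ^ n ∣ a (n + m) - a n := by
    intro n
    induction n with
    | zero => intro m; simp
    | succ n ih =>
      intro m
      rw [hsucc n, show n + 1 + m = n + m + 1 by omega, hsucc (n + m)]
      exact hΦ n _ _ (ih m)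
  set V : ℚ⟦X⟧ := PowerSeries.mk fun n => PowerSeries.coeff n (a (n + 1)) with hV
  have h2 : ∀ n, X ^ n ∣ V - a n := by
    intro n
    rw [PowerSeries.X_pow_dvd_iff]
    intro j hj
    obtain ⟨m, rfl⟩ := Nat.exists_eq_add_of_lt hj
    have := PowerSeries.X_pow_dvd_iff.1 (h1 (j + 1) m) j (by omega)
    rw [map_sub, sub_eq_zero] at this
    rw [map_sub, hV, PowerSeries.coeff_mk, ← this, show j + 1 + m = j + m + 1 by omega, sub_self]
  refine ⟨V, sub_eq_zero.1 (eq_zero_of_forall_X_pow_dvd fun k => ?_)⟩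
  have h3 := dvd_sub (hΦ k _ _ (h2 k)) (h2 (k + 1))
  rw [hsucc] at h3
  refine (pow_dvd_pow X (Nat.le_succ k)).trans ?_
  convert h3 using 1
  ring

/-- The generating function of the avoiders, with the power series `W` substituted for the
variable that marks `free`. -/
noncomputable def ySubst (W : ℚ⟦X⟧) : ℚ⟦X⟧ := diag (Y W)

theorem ySubst_one : ySubst 1 = Y (1 : ℚ) := by
  rw [ySubst, ← diag_map_C (Y (1 : ℚ))]
  congr 1
  ext1 n
  simp [Y]

theorem ySubst_functional_equation (W : ℚ⟦X⟧) :
    X * W ^ 2 * ySubst W ^ 2 - Y (1 : ℚ) * (W - 1 + X * W) * ySubst W + Y (1 : ℚ) * (W - 1) = 0 := by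
  have hX : diag (X : ℚ⟦X⟧⟦X⟧) = X := by
    rw [← diag_map_C (X : ℚ⟦X⟧), PowerSeries.map_X]
  have := congrArg diag (functional_equation W)
  simp only [map_add, map_sub, map_mul, map_pow, map_one, map_zero, hX, diag_C] at this
  rw [← ySubst_one]
  exact this

theorem X_pow_dvd_ySubst_sub {k : ℕ} {W W' : ℚ⟦X⟧} (h : X ^ k ∣ W - W') :
    X ^ k ∣ ySubst W - ySubst W' := by
  rw [PowerSeries.X_pow_dvd_iff]
  intro m hm
  rw [ySubst, ySubst, ← map_sub, coeff_diag]
  refine Finset.sum_eq_zero fun x hx => ?_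
  have hd : X ^ k ∣ PowerSeries.coeff x.2 (Y W - Y W') := by
    rw [map_sub, ← coeff_Y W 0, ← coeff_Y W' 0, ← Finset.sum_sub_distrib]
    exact Finset.dvd_sum fun l _ => h.trans (sub_dvd_pow_sub_pow ..)
  refine PowerSeries.X_pow_dvd_iff.1 hd x.1 ?_
  have := mem_antidiagonal.1 hx
  omega

theorem constantCoeff_Y_one : PowerSeries.constantCoeff (Y (1 : ℚ)) = 1 := by
  rw [← PowerSeries.coeff_zero_eq_constantCoeff_apply, coeff_zero_Y]

theorem Y_one_ne_zero : Y (1 : ℚ) ≠ 0 := fun h => by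
  have := constantCoeff_Y_one
  simp [h] at this

/-- The quadratic method: after the substitution `u = 1 + X * V` the discriminant of the
functional equation is a square that vanishes to first order at some power series `V`; hence the
cubic polynomial `h * ((1 + X) * V + 1) ^ 2 - 4 * V * (1 + X * V) ^ 2` in `V` and its derivative
both vanish there. -/
theorem exists_double_root : ∃ V : ℚ⟦X⟧,
    Y 1 * ((1 + X) * V + 1) ^ 2 - 4 * V * (1 + X * V) ^ 2 = 0 ∧
    2 * Y 1 * (1 + X) * ((1 + X) * V + 1) - 4 * (1 + X * V) ^ 2
      - 8 * X * V * (1 + X * V) = 0 := by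
  set h : ℚ⟦X⟧ := Y 1 with hh
  have hinv : h * h⁻¹ = 1 := PowerSeries.mul_inv_cancel _ (by simp [hh, constantCoeff_Y_one])
  set A : ℚ⟦X⟧ → ℚ⟦X⟧ := fun V => 2 * (1 + X * V) ^ 2 * ySubst (1 + X * V) with hA
  set z : ℚ⟦X⟧ → ℚ⟦X⟧ := fun V => A V - h * ((1 + X) * V + 1) with hz
  set E : ℚ⟦X⟧ → ℚ⟦X⟧ := fun V => h * ((1 + X) * V + 1) ^ 2 - 4 * V * (1 + X * V) ^ 2 with hE
  have hzE : ∀ V, z V ^ 2 = h * E V := by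
    intro V
    have h1 := ySubst_functional_equation (1 + X * V)
    rw [← hh] at h1
    have h2 : X * ((1 + X * V) ^ 2 * ySubst (1 + X * V) ^ 2
        - h * (V + (1 + X * V)) * ySubst (1 + X * V) + h * V) = 0 := by
      linear_combination h1
    have h3 := (mul_eq_zero.1 h2).resolve_left PowerSeries.X_ne_zero
    simp only [hz, hE, hA]
    linear_combination 4 * (1 + X * V) ^ 2 * h3
  have hcontr : ∀ (k : ℕ) (V V' : ℚ⟦X⟧), X ^ k ∣ V - V' → X ^ (k + 1) ∣ A V - A V' := by
    intro k V V' hk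
    have h1 : X ^ (k + 1) ∣ (1 + X * V) - (1 + X * V') := by
      rw [pow_succ', add_sub_add_left_eq_sub, ← mul_sub]
      exact mul_dvd_mul_left X hk
    have h2 := X_pow_dvd_ySubst_sub h1
    have h3 : A V - A V' = 2 * (1 + X * V) ^ 2 * (ySubst (1 + X * V) - ySubst (1 + X * V')) +
        ((1 + X * V) - (1 + X * V')) *
          (2 * ((1 + X * V) + (1 + X * V')) * ySubst (1 + X * V')) := by
      simp only [hA]; ring
    rw [h3]
    exact dvd_add (h2.mul_left _) (h1.mul_right _)
  obtain ⟨V, hV⟩ := exists_fixed_point (fun V => h⁻¹ * A V - 1 - X * V) (by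
    intro k V V' hk
    have h1 : h⁻¹ * A V - 1 - X * V - (h⁻¹ * A V' - 1 - X * V') =
        h⁻¹ * (A V - A V') - X * (V - V') := by ring
    rw [h1]
    refine dvd_sub ((hcontr k V V' hk).mul_left _) ?_
    rw [pow_succ']
    exact mul_dvd_mul_left X hk)
  -- `z V` is a square root of the discriminant, and its zeros are the fixed points above.
  have hz0 : z V = 0 := by
    simp only [hz]
    linear_combination h * hV - A V * hinv
  have hE0 : E V = 0 := by
    have := hzE V
    rw [hz0, zero_pow two_ne_zero, eq_comm] at this
    exact (mul_eq_zero.1 this).resolve_left Y_one_ne_zero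
  refine ⟨V, hE0, ?_⟩
  set E' : ℚ⟦X⟧ := 2 * h * (1 + X) * ((1 + X) * V + 1) - 4 * (1 + X * V) ^ 2
      - 8 * X * V * (1 + X * V) with hE'
  suffices h * E' = 0 from (mul_eq_zero.1 this).resolve_left Y_one_ne_zero
  -- Compare the discriminant at `V` and at `V + X ^ k`, where it is divisible by `X ^ (2 * k)`.
  refine eq_zero_of_forall_X_pow_dvd fun k => ?_
  have h1 : X ^ k ∣ z (V + X ^ k) := by
    have h2 := hcontr k (V + X ^ k) V (by simp)
    have h3 : z (V + X ^ k) = A (V + X ^ k) - A V - X ^ k * (h * (1 + X)) := by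
      have := hz0
      simp only [hz] at this ⊢
      linear_combination this
    rw [h3]
    exact dvd_sub ((pow_dvd_pow X (Nat.le_succ k)).trans h2) (Dvd.intro _ rfl)
  have h2 : X ^ k * X ^ k ∣ h * E (V + X ^ k) := by
    rw [← hzE, pow_two]
    exact mul_dvd_mul h1 h1
  have h3 : h * E (V + X ^ k) = X ^ k * (h * E') + X ^ k * X ^ k *
      (h * (h * (1 + X) ^ 2 - 8 * X - 12 * X ^ 2 * V - 4 * X ^ 2 * X ^ k)) := by
    have := hE0
    simp only [hE] at this ⊢
    rw [hE']
    linear_combination h * this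
  rw [h3, dvd_add_left (Dvd.intro _ rfl)] at h2
  exact (mul_dvd_mul_iff_left (pow_ne_zero k PowerSeries.X_ne_zero)).1 h2

theorem oneSubEightXPow_sq : oneSubEightXPow ^ 2 = (1 - 8 * X) ^ 3 := by
  have h : (PowerSeries.binomialSeries ℚ (3 / 2 : ℚ)) ^ 2 = (1 + X) ^ 3 := by
    rw [pow_two, ← PowerSeries.binomialSeries_add,
      show (3 / 2 + 3 / 2 : ℚ) = ((3 : ℕ) : ℚ) by norm_num, PowerSeries.binomialSeries_nat]
  rw [oneSubEightXPow, ← map_pow, h]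
  simp only [map_pow, map_add, map_one, PowerSeries.rescale_X]
  congr 1
  rw [map_neg, show (C (8 : ℚ) : ℚ⟦X⟧) = 8 from map_ofNat C 8]
  ring

theorem constantCoeff_oneSubEightXPow :
    PowerSeries.constantCoeff oneSubEightXPow = 1 := by
  rw [← PowerSeries.coeff_zero_eq_constantCoeff_apply, oneSubEightXPow, PowerSeries.coeff_rescale]
  simp

/-- The double root `V` satisfies `(1 + X) * X * V ^ 2 - V + 2 * X * V + 1 = 0`, so `V`, and with it
`Y 1`, is rational in `X` and a square root `r` of `1 - 8 * X`. -/
theorem Y_one_mul : Y (1 : ℚ) * (1 + 20 * X - 8 * X ^ 2 - oneSubEightXPow) = 32 * X := by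
  obtain ⟨V, h1, h2⟩ := exists_double_root
  set h : ℚ⟦X⟧ := Y 1 with hh
  set U : ℚ⟦X⟧ := 1 + X * V with hU
  set r : ℚ⟦X⟧ := 3 - 2 * ((1 + X) * U) with hr
  have hc3 : PowerSeries.constantCoeff (3 : ℚ⟦X⟧) = 3 := map_ofNat _ 3
  have hc2 : PowerSeries.constantCoeff (2 : ℚ⟦X⟧) = 2 := map_ofNat _ 2
  have hc4 : (4 : ℚ⟦X⟧) ≠ 0 := fun h0 => by
    have := congrArg PowerSeries.constantCoeff h0
    rw [map_ofNat, map_zero] at this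
    norm_num at this
  have hc8 : (8 : ℚ⟦X⟧) ≠ 0 := fun h0 => by
    have := congrArg PowerSeries.constantCoeff h0
    rw [map_ofNat, map_zero] at this
    norm_num at this
  have hU1 : PowerSeries.constantCoeff U = 1 := by simp [hU]
  have hr1 : PowerSeries.constantCoeff r = 1 := by
    simp [hr, hU1, hc3, hc2]; norm_num
  have hU0 : U ≠ 0 := fun h0 => by simp [h0] at hU1
  -- The combination of the cubic and its derivative in which `h` cancels.
  have h3 : (1 + X) * X * V ^ 2 - V + 2 * X * V + 1 = 0 := by
    have h4 : 4 * U * ((1 + X) * X * V ^ 2 - V + 2 * X * V + 1) = 0 := by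
      rw [hU] at h1 h2 ⊢
      linear_combination 2 * (1 + X) * h1 - ((1 + X) * V + 1) * h2
    exact (mul_eq_zero.1 h4).resolve_left (mul_ne_zero hc4 hU0)
  have hr2 : r ^ 2 = 1 - 8 * X := by
    rw [hr, hU]
    linear_combination 4 * (1 + X) * X * h3
  have hq : oneSubEightXPow = r ^ 3 := by
    have h4 : (oneSubEightXPow - r ^ 3) * (oneSubEightXPow + r ^ 3) = 0 := by
      have h5 : (r ^ 3) ^ 2 = (1 - 8 * X) ^ 3 := by rw [← hr2]; ring
      linear_combination oneSubEightXPow_sq - h5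
    refine sub_eq_zero.1 ((mul_eq_zero.1 h4).resolve_right fun h0 => ?_)
    have := congrArg PowerSeries.constantCoeff h0
    simp [constantCoeff_oneSubEightXPow, hr1] at this
  -- Both `X` and `(1 + X) * U` are polynomials in `r`; substitute them into `h1`.
  have h2d : 2 * ((1 + X) * U) = 3 - r := by rw [hr]; ring
  have h8c : 8 * (1 + X) = (3 - r) * (3 + r) := by linear_combination hr2
  have h5 : h * (8 * (1 + X)) ^ 3 * (2 * ((1 + X) * U) - 2) ^ 2 =
      256 * X * (2 * ((1 + X) * U)) ^ 2 * (4 * (2 * ((1 + X) * U)) - 8 * (1 + X)) := by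
    rw [hU] at h1 ⊢
    linear_combination 2048 * (1 + X) ^ 3 * X ^ 2 * h1
  rw [h8c, h2d] at h5
  have h6 : (3 - r) ^ 3 * (1 - r) * (h * ((3 + r) ^ 3 * (1 - r)) - 256 * X) = 0 := by
    linear_combination h5
  have h3r : (3 - r) ^ 3 ≠ 0 := pow_ne_zero _ fun h0 => by
    have := congrArg PowerSeries.constantCoeff h0
    simp [hc3, hr1] at this
    norm_num at this
  have h1r : 1 - r ≠ 0 := fun h0 => by
    have h7 : r = 1 := by linear_combination -h0
    rw [h7] at hr2
    have h8 : (8 : ℚ⟦X⟧) * X = 0 := by linear_combination hr2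
    exact mul_ne_zero hc8 PowerSeries.X_ne_zero h8
  have h7 := (mul_eq_zero.1 h6).resolve_left (mul_ne_zero h3r h1r)
  have h8 : (8 : ℚ⟦X⟧) * (h * (1 + 20 * X - 8 * X ^ 2 - r ^ 3) - 32 * X) = 0 := by
    have hX : 8 * X = 1 - r ^ 2 := by linear_combination hr2
    have h9 : 8 * (1 + 20 * X - 8 * X ^ 2 - r ^ 3) = (3 + r) ^ 3 * (1 - r) := by
      linear_combination (20 - (8 * X + 1 - r ^ 2)) * hX
    linear_combination h7 + h * h9
  rw [hq]
  exact sub_eq_zero.1 ((mul_eq_zero.1 h8).resolve_left hc8)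

/-! ### The closed form of `F` -/

theorem coeff_succ_oneSubEightXPow (n : ℕ) :
    ((n : ℚ) + 1) * PowerSeries.coeff (n + 1) oneSubEightXPow =
      (8 * n - 12) * PowerSeries.coeff n oneSubEightXPow := by
  have h : ((n : ℚ) + 1) * Ring.choose (3 / 2 : ℚ) (n + 1) =
      (3 / 2 - n) * Ring.choose (3 / 2 : ℚ) n := by
    have h1 := Ring.descPochhammer_eq_factorial_smul_choose (3 / 2 : ℚ) n
    have h2 := Ring.descPochhammer_eq_factorial_smul_choose (3 / 2 : ℚ) (n + 1)
    rw [descPochhammer_succ_right, Polynomial.smeval_mul, h1, Polynomial.smeval_sub,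
      Polynomial.smeval_X, Polynomial.smeval_natCast, Nat.factorial_succ] at h2
    simp only [nsmul_eq_mul, pow_one, pow_zero, mul_one] at h2
    have h3 : ((n ! : ℕ) : ℚ) ≠ 0 := by positivity
    apply mul_left_cancel₀ h3
    push_cast at h2
    linear_combination -h2
  simp only [oneSubEightXPow, PowerSeries.coeff_rescale, PowerSeries.binomialSeries_coeff,
    smul_eq_mul, mul_one]
  rw [pow_succ]
  linear_combination (-8) ^ n * (-8) * h

/-- The recurrence of `t` has the same ratios as that of the coefficients of `oneSubEightXPow`. -/
theorem t_succ (m : ℕ) : ((m : ℚ) + 4) * t (m + 3) = 4 * (2 * m + 3) * t (m + 2) := by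
  simp only [t]
  have h1 : 2 * (m + 1) + 2 = 2 * m + 2 + 1 + 1 := by ring
  rw [h1, show m + 1 + 3 = m + 3 + 1 by ring, Nat.factorial_succ (2 * m + 2 + 1),
    Nat.factorial_succ (2 * m + 2), Nat.factorial_succ (m + 3), Nat.factorial_succ (m + 1)]
  have h2 : ((m + 3)! : ℚ) ≠ 0 := by positivity
  have h3 : ((m + 1)! : ℚ) ≠ 0 := by positivity
  push_cast
  field_simp
  ring

theorem t_add_two (m : ℕ) : 32 * t (m + 2) = PowerSeries.coeff (m + 3) oneSubEightXPow := by
  induction m with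
  | zero =>
    have h0 := constantCoeff_oneSubEightXPow
    rw [← PowerSeries.coeff_zero_eq_constantCoeff_apply] at h0
    have h1 := coeff_succ_oneSubEightXPow 0
    have h2 := coeff_succ_oneSubEightXPow 1
    have h3 := coeff_succ_oneSubEightXPow 2
    norm_num [t, Nat.factorial] at *
    linarith
  | succ m ih =>
    have h1 := coeff_succ_oneSubEightXPow (m + 3)
    have h2 := t_succ m
    rw [← ih] at h1
    have h3 : (m : ℚ) + 4 ≠ 0 := by positivity
    apply mul_left_cancel₀ h3
    push_cast at h1
    rw [show m + 1 + 2 = m + 3 by ring, show m + 1 + 3 = m + 3 + 1 by ring]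
    linear_combination 32 * h2 - h1

theorem F_eq : 32 * X * F = 8 * X ^ 2 + 12 * X - 1 + oneSubEightXPow := by
  have h8 : (8 : ℚ⟦X⟧) = C 8 := (map_ofNat C 8).symm
  have h12 : (12 : ℚ⟦X⟧) = C 12 := (map_ofNat C 12).symm
  have h32 : (32 : ℚ⟦X⟧) = C 32 := (map_ofNat C 32).symm
  have h0 := constantCoeff_oneSubEightXPow
  rw [← PowerSeries.coeff_zero_eq_constantCoeff_apply] at h0
  have h1 := coeff_succ_oneSubEightXPow 0
  have h2 := coeff_succ_oneSubEightXPow 1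
  norm_num [constantCoeff_oneSubEightXPow] at h1 h2
  ext n
  rw [h8, h12, h32, mul_assoc, map_add, map_sub, map_add, PowerSeries.coeff_C_mul,
    PowerSeries.coeff_C_mul, PowerSeries.coeff_C_mul, PowerSeries.coeff_X_pow,
    PowerSeries.coeff_X, PowerSeries.coeff_one]
  rcases n with _ | _ | _ | n
  · simp [h0]
  · rw [PowerSeries.coeff_succ_X_mul]
    simp [F, t]
    linarith
  · rw [PowerSeries.coeff_succ_X_mul]
    simp [F, t]
    linarith
  · rw [PowerSeries.coeff_succ_X_mul, F, PowerSeries.coeff_mk]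
    have := t_add_two n
    simp [this]

/-! ### Indecomposable lists -/

/-- The list `l` is not the direct sum of two nonempty lists: at no cut are all entries before the
cut smaller than all entries after it. -/
def DirectIndec (l : List ℕ) : Prop :=
  ∀ k, 0 < k → k < l.length → ¬ ∀ y ∈ l.take k, ∀ z ∈ l.drop k, y < z

open Classical in
/-- The nonempty indecomposable 3241-avoiding arrangements of `[0, n)`. -/
noncomputable def indecAvoiders (n : ℕ) : Finset (List ℕ) :=
  (avoiders 0 n).filter fun l => l ≠ [] ∧ DirectIndec l

theorem mem_indecAvoiders {n : ℕ} {l : List ℕ} :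
    l ∈ indecAvoiders n ↔ (Fills 0 n l ∧ Av3241 l) ∧ l ≠ [] ∧ DirectIndec l := by
  classical
  rw [indecAvoiders, Finset.mem_filter, mem_avoiders]

/-- The first direct summand of a nonempty list: cut at the first admissible place. -/
theorem exists_indec_append {l : List ℕ} (hl : l ≠ []) : ∃ B C, l = B ++ C ∧ B ≠ [] ∧
    DirectIndec B ∧ ∀ s ∈ B, ∀ s' ∈ C, s < s' := by
  classical
  have hpos : 0 < l.length := List.length_pos_of_ne_nil hl
  have hex : ∃ k, 0 < k ∧ k ≤ l.length ∧ ∀ y ∈ l.take k, ∀ z ∈ l.drop k, y < z :=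
    ⟨l.length, hpos, le_rfl, by simp⟩
  obtain ⟨h1, h2, h3⟩ := Nat.find_spec hex
  set k := Nat.find hex
  refine ⟨l.take k, l.drop k, (List.take_append_drop k l).symm, ?_, fun j hj hjk hcut => ?_, h3⟩
  · intro h
    rcases List.take_eq_nil_iff.1 h with h | h
    · exact h1.ne' h
    · exact hl h
  · rw [List.length_take, min_eq_left h2] at hjk
    refine Nat.find_min hex hjk ⟨hj, by omega, fun y hy z hz => ?_⟩
    rw [List.take_take, min_eq_left hjk.le] at hcut
    have hz' : z ∈ (l.take k).drop j ++ l.drop k := by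
      have h4 : l.drop j = (l.take k).drop j ++ l.drop k := by
        conv_lhs => rw [← List.take_append_drop k l]
        rw [List.drop_append_of_le_length (by simp; omega)]
      rwa [← h4]
    rcases List.mem_append.1 hz' with hz' | hz'
    · exact hcut y hy z hz'
    · refine h3 y ?_ z hz'
      exact List.take_subset_take_left l hjk.le hy

/-- An indecomposable prefix is at most as long as any nonempty direct summand in front, so the
first indecomposable summand is unique. -/
theorem DirectIndec.length_le {B B' C C' : List ℕ} (hB' : DirectIndec B') (hB : B ≠ [])
    (hlt : ∀ s ∈ B, ∀ s' ∈ C, s < s') (h : B ++ C = B' ++ C') : B'.length ≤ B.length := by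
  by_contra hlen
  rcases List.append_eq_append_iff.1 h with ⟨a, rfl, rfl⟩ | ⟨a, rfl, _⟩
  · refine hB' B.length (List.length_pos_of_ne_nil hB) (by omega) fun y hy z hz => ?_
    rw [List.take_left' rfl] at hy
    rw [List.drop_left' rfl] at hz
    exact hlt y hy z (by simp [hz])
  · simp at hlen

/-- Splitting off the first direct summand. -/
theorem card_avoiders_succ (n : ℕ) : (avoiders 0 (n + 1)).card =
    ∑ x ∈ antidiagonal (n + 1), (indecAvoiders x.1).card * (avoiders 0 x.2).card := by
  have hc : ∀ x : ℕ × ℕ, (indecAvoiders x.1).card * (avoiders 0 x.2).card =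
      ∑ _B ∈ indecAvoiders x.1, ∑ _C ∈ avoiders x.1 x.2, 1 := fun x => by
    have := sum_avoiders_shift x.1 x.2 fun _ => 1
    rw [this]; simp
  simp_rw [hc, Finset.card_eq_sum_ones (avoiders 0 (n + 1)), Finset.sum_sigma']
  refine sum_eq_sum_of_decomposition
    (fun z : (Σ _ : ℕ × ℕ, Σ _ : List ℕ, List ℕ) => z.2.1 ++ z.2.2) ?_ (fun l => ?_) fun _ => 1
  · rintro ⟨⟨b, c⟩, B, C⟩ h1 ⟨⟨b', c'⟩, B', C'⟩ h2 h
    simp only [Finset.coe_sigma, Set.mem_sigma_iff, Finset.mem_coe, mem_antidiagonal,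
      mem_indecAvoiders, mem_avoiders] at h1 h2
    obtain ⟨hn, ⟨⟨hB, _⟩, hne, hi⟩, hC, _⟩ := h1
    obtain ⟨hn', ⟨⟨hB', _⟩, hne', hi'⟩, hC', _⟩ := h2
    dsimp only at h
    have hl := hB.length
    have hl' := hB'.length
    have hle := hi'.length_le hne (fun s hs s' hs' => by
      have := (hB.2 s).1 hs; have := (hC.2 s').1 hs'; omega) h
    have hle' := hi.length_le hne' (fun s hs s' hs' => by
      have := (hB'.2 s).1 hs; have := (hC'.2 s').1 hs'; omega) h.symm
    obtain ⟨rfl, rfl⟩ := List.append_inj h (by omega)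
    obtain rfl : b = b' := by omega
    obtain rfl : c = c' := by omega
    rfl
  · simp only [Finset.mem_sigma, mem_antidiagonal, mem_indecAvoiders, mem_avoiders]
    constructor
    · rintro ⟨hf, ha⟩
      have hne : l ≠ [] := by
        rintro rfl
        have := hf.length
        simp at this
      obtain ⟨B, C, rfl, hB, hi, hlt⟩ := exists_indec_append hne
      obtain ⟨c, hc, hfB, hfC⟩ := hf.of_append hlt
      rw [zero_add] at hfC
      exact ⟨⟨(B.length, c), B, C⟩, ⟨hc, ⟨⟨hfB, ha.sublist (List.sublist_append_left ..)⟩, hB, hi⟩,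
        hfC, ha.sublist (List.sublist_append_right ..)⟩, rfl⟩
    · rintro ⟨⟨⟨b, c⟩, B, C⟩, ⟨hn, ⟨⟨hB, haB⟩, -, -⟩, hC, haC⟩, rfl⟩
      dsimp only at hn hB hC ⊢
      rw [← hn]
      refine ⟨hB.append (by rwa [zero_add]), haB.append haC fun s hs s' hs' => ?_⟩
      have := (hB.2 s).1 hs; have := (hC.2 s').1 hs'; omega

theorem Y_one_mul_one_sub_F : Y (1 : ℚ) * (1 - F) = 1 := by
  have h32 : (32 : ℚ⟦X⟧) ≠ 0 := fun h0 => by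
    have := congrArg PowerSeries.constantCoeff h0
    rw [map_ofNat, map_zero] at this
    norm_num at this
  apply mul_left_cancel₀ (mul_ne_zero h32 PowerSeries.X_ne_zero)
  linear_combination Y_one_mul - Y 1 * F_eq

theorem card_avoiders_eq_coeff (n : ℕ) :
    ((avoiders 0 n).card : ℚ) = PowerSeries.coeff n (Y (1 : ℚ)) := by
  rw [← coeff_Y 1 0]; simp

/-- Each nonempty avoider is a direct sum of an indecomposable one and an arbitrary one, which
determines the number of the indecomposable ones. -/
theorem mk_card_indecAvoiders :
    (PowerSeries.mk fun n => ((indecAvoiders n).card : ℚ)) = F := by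
  set I : ℚ⟦X⟧ := PowerSeries.mk fun n => ((indecAvoiders n).card : ℚ) with hI
  have h : Y (1 : ℚ) = 1 + I * Y 1 := by
    ext n
    rw [map_add, PowerSeries.coeff_mul, PowerSeries.coeff_one]
    rcases n with _ | n
    · have h0 : indecAvoiders 0 = ∅ := by
        ext l
        rw [mem_indecAvoiders, fills_zero_iff]
        simp; tauto
      rw [coeff_zero_Y]
      simp [hI, h0]
    · rw [← card_avoiders_eq_coeff, card_avoiders_succ, if_neg (by omega), zero_add]
      push_cast
      refine Finset.sum_congr rfl fun x _ => ?_
      rw [hI, PowerSeries.coeff_mk, card_avoiders_eq_coeff]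
  apply mul_left_cancel₀ Y_one_ne_zero
  linear_combination -h + Y_one_mul_one_sub_F

end Solution

/-! ### From permutations to lists -/

/-- The diagram of the permutation `p` turned by a quarter, as a list of values: the entry at
position `i` is the position of the `i`-th largest value of `p`. This turns the pattern 1342 into
3241, and skew sums into direct sums. -/
def quarterTurn {n : ℕ} (p : Equiv.Perm (Fin n)) : List ℕ :=
  List.ofFn fun i => (p.symm i.rev : ℕ)

theorem fills_quarterTurn {n : ℕ} (p : Equiv.Perm (Fin n)) : Fills 0 n (quarterTurn p) := by
  refine ⟨List.nodup_ofFn.2 fun i j h => ?_, fun y => ?_⟩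
  · exact Fin.rev_injective (p.symm.injective (Fin.ext h))
  · rw [quarterTurn, List.mem_ofFn]
    constructor
    · rintro ⟨i, rfl⟩
      simp
    · rintro ⟨-, h⟩
      rw [zero_add] at h
      exact ⟨(p ⟨y, h⟩).rev, by simp⟩

theorem quarterTurn_injective {n : ℕ} :
    Function.Injective (quarterTurn : Equiv.Perm (Fin n) → List ℕ) := by
  intro p p' h
  have h1 := List.ofFn_injective h
  rw [← Equiv.symm_bijective.injective.eq_iff]
  ext i
  have := congrFun h1 i.rev
  simpa using this

theorem exists_quarterTurn_eq {n : ℕ} {l : List ℕ} (h : Fills 0 n l) :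
    ∃ p : Equiv.Perm (Fin n), quarterTurn p = l := by
  have hl := h.length
  subst hl
  have hlt : ∀ i : Fin l.length, l[i] < l.length := fun i => by
    have := (h.2 l[i]).1 (by simp)
    omega
  have hinj : Function.Injective fun i : Fin l.length => (⟨l[i], hlt i⟩ : Fin l.length) := by
    intro i j hij
    exact List.nodup_iff_injective_get.1 h.1 (by simpa using hij)
  refine ⟨(Fin.revPerm.trans
    (Equiv.ofBijective _ (Finite.injective_iff_bijective.1 hinj))).symm, ?_⟩
  simp [quarterTurn]

theorem card_perm_eq {n : ℕ} {P : Equiv.Perm (Fin n) → Prop} {s : Finset (List ℕ)}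
    (hs : ∀ l ∈ s, Fills 0 n l) (hP : ∀ p, P p ↔ quarterTurn p ∈ s) :
    Nat.card {p // P p} = s.card := by
  rw [← Fintype.card_coe, ← Nat.card_eq_fintype_card]
  refine Nat.card_congr (Equiv.ofBijective (fun p => ⟨quarterTurn p.1, (hP _).1 p.2⟩) ⟨?_, ?_⟩)
  · intro p p' h
    exact Subtype.ext (quarterTurn_injective (congrArg Subtype.val h))
  · rintro ⟨l, hl⟩
    obtain ⟨p, rfl⟩ := exists_quarterTurn_eq (hs l hl)
    exact ⟨⟨p, (hP p).2 hl⟩, rfl⟩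

theorem sublist_ofFn_iff {n : ℕ} (g : Fin n → ℕ) (a b c d : ℕ) :
    [a, b, c, d].Sublist (List.ofFn g) ↔
      ∃ e : Fin 4 ↪o Fin n, g (e 0) = a ∧ g (e 1) = b ∧ g (e 2) = c ∧ g (e 3) = d := by
  rw [List.sublist_iff_exists_fin_orderEmbedding_get_eq]
  constructor
  · rintro ⟨f, hf⟩
    refine ⟨f.trans (Fin.castOrderIso (List.length_ofFn)).toOrderEmbedding, ?_⟩
    have h0 := hf (0 : Fin 4)
    have h1 := hf (1 : Fin 4)
    have h2 := hf (2 : Fin 4)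
    have h3 := hf (3 : Fin 4)
    simp at h0 h1 h2 h3
    exact ⟨h0.symm, h1.symm, h2.symm, h3.symm⟩
  · rintro ⟨e, h0, h1, h2, h3⟩
    refine ⟨e.trans (Fin.castOrderIso (List.length_ofFn).symm).toOrderEmbedding, fun i => ?_⟩
    change Fin 4 at i
    fin_cases i <;> simp [h0, h1, h2, h3]

theorem strictMono_four {n : ℕ} {a b c d : Fin n} (h1 : a < b) (h2 : b < c) (h3 : c < d) :
    StrictMono ![a, b, c, d] := by
  rw [Fin.strictMono_iff_lt_succ]
  intro i
  fin_cases i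
  · exact h1
  · exact h2
  · exact h3

/-- An occurrence of 1342 at positions `e 0 < e 1 < e 2 < e 3` becomes an occurrence of 3241 with
entries `e 2, e 1, e 3, e 0`. -/
theorem avoids_iff {n : ℕ} (p : Equiv.Perm (Fin n)) :
    Avoids pattern1342 p ↔ Av3241 (quarterTurn p) := by
  constructor
  · rintro h a b c d hs ⟨hdb, hba, hac⟩
    obtain ⟨j, rfl, rfl, rfl, rfl⟩ := (sublist_ofFn_iff _ _ _ _ _).1 hs
    refine h ⟨OrderEmbedding.ofStrictMono _ (strictMono_four (Fin.lt_def.2 hdb)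
      (Fin.lt_def.2 hba) (Fin.lt_def.2 hac)), fun x y => ?_⟩
    have hf : StrictMono ![(j 3).rev, (j 2).rev, (j 1).rev, (j 0).rev] :=
      strictMono_four (Fin.rev_lt_rev.2 (j.strictMono (by decide)))
        (Fin.rev_lt_rev.2 (j.strictMono (by decide))) (Fin.rev_lt_rev.2 (j.strictMono (by decide)))
    have key : ∀ x : Fin 4, p (![p.symm (j 3).rev, p.symm (j 1).rev, p.symm (j 0).rev,
        p.symm (j 2).rev] x) = ![(j 3).rev, (j 2).rev, (j 1).rev, (j 0).rev] (pattern1342 x) := by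
      intro x
      fin_cases x <;> simp [pattern1342]
    rw [OrderEmbedding.coe_ofStrictMono, key, key]
    exact hf.lt_iff_lt
  · rintro h ⟨e, he⟩
    have h1 : p (e 0) < p (e 3) := (he 0 3).2 (by decide)
    have h2 : p (e 3) < p (e 1) := (he 3 1).2 (by decide)
    have h3 : p (e 1) < p (e 2) := (he 1 2).2 (by decide)
    refine h (e 2) (e 1) (e 3) (e 0) ((sublist_ofFn_iff _ _ _ _ _).2
      ⟨OrderEmbedding.ofStrictMono _ (strictMono_four (Fin.rev_lt_rev.2 h3)
        (Fin.rev_lt_rev.2 h2) (Fin.rev_lt_rev.2 h1)), ?_⟩) ⟨?_, ?_, ?_⟩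
    · simp
    · exact Fin.lt_def.1 (e.strictMono (by decide))
    · exact Fin.lt_def.1 (e.strictMono (by decide))
    · exact Fin.lt_def.1 (e.strictMono (by decide))

/-- If a permutation is a direct sum cut at `k`, then so is its inverse. -/
theorem cut_symm {n k : ℕ} {p : Equiv.Perm (Fin n)}
    (h : ∀ i j : Fin n, (i : ℕ) < k → k ≤ (j : ℕ) → p i < p j) :
    ∀ i j : Fin n, (i : ℕ) < k → k ≤ (j : ℕ) → p.symm i < p.symm j := by
  have key : ∀ j : Fin n, k ≤ (j : ℕ) → k ≤ (p j : ℕ) := by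
    intro j hj
    have hk : k < n := lt_of_le_of_lt hj j.2
    have hsub : (Finset.Iio (⟨k, hk⟩ : Fin n)).image p ⊆ Finset.Iio (p j) := by
      intro y hy
      obtain ⟨i, hi, rfl⟩ := Finset.mem_image.1 hy
      rw [Finset.mem_Iio] at hi ⊢
      exact h i j (Fin.lt_def.1 hi) hj
    have := Finset.card_le_card hsub
    rwa [Finset.card_image_of_injective _ p.injective, Fin.card_Iio, Fin.card_Iio] at this
  have key' : ∀ i : Fin n, (i : ℕ) < k → (p i : ℕ) < k := by
    intro i hi
    rcases Nat.lt_or_ge k n with hk | hk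
    · have hsub : (Finset.Ici (⟨k, hk⟩ : Fin n)).image p ⊆ Finset.Ioi (p i) := by
        intro y hy
        obtain ⟨j, hj, rfl⟩ := Finset.mem_image.1 hy
        rw [Finset.mem_Ici] at hj
        rw [Finset.mem_Ioi]
        exact h i j hi (Fin.le_def.1 hj)
      have := Finset.card_le_card hsub
      rw [Finset.card_image_of_injective _ p.injective, Fin.card_Ici, Fin.card_Ioi] at this
      simp only at this
      omega
    · exact (p i).2.trans_le hk
  intro i j hi hj
  have h1 : (p.symm i : ℕ) < k := by
    by_contra hlt
    have := key (p.symm i) (by omega)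
    rw [Equiv.apply_symm_apply] at this
    omega
  have h2 : k ≤ (p.symm j : ℕ) := by
    by_contra hlt
    have := key' (p.symm j) (by omega)
    rw [Equiv.apply_symm_apply] at this
    omega
  exact Fin.lt_def.2 (by omega)

/-- A cut of `p` into a skew sum is a cut of the inverse of `quarterTurn p` into a direct sum. -/
theorem indecomposable_iff {n : ℕ} (p : Equiv.Perm (Fin n)) :
    Indecomposable p ↔ DirectIndec (quarterTurn p) := by
  have hlist : ∀ k, (∀ y ∈ (quarterTurn p).take k, ∀ z ∈ (quarterTurn p).drop k, y < z) ↔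
      ∀ i j : Fin n, (i : ℕ) < k → k ≤ (j : ℕ) →
        (p.trans Fin.revPerm).symm i < (p.trans Fin.revPerm).symm j := by
    intro k
    constructor
    · intro h i j hi hj
      refine Fin.lt_def.2 (h _ ?_ _ ?_)
      · rw [List.mem_take_iff_getElem]
        exact ⟨i, by simp [quarterTurn, hi], by simp [quarterTurn]⟩
      · rw [List.mem_drop_iff_getElem]
        exact ⟨j - k, by simp [quarterTurn]; omega, by simp [quarterTurn, Nat.add_sub_cancel' hj]⟩
    · intro h y hy z hz
      obtain ⟨i, hi, rfl⟩ := List.mem_take_iff_getElem.1 hy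
      obtain ⟨j, hj, rfl⟩ := List.mem_drop_iff_getElem.1 hz
      simp only [quarterTurn, List.length_ofFn, lt_min_iff] at hi hj
      have := Fin.lt_def.1 (h ⟨i, hi.2⟩ ⟨k + j, by omega⟩ hi.1 (by simp))
      simpa [quarterTurn] using this
  have hcut : ∀ k, (∀ i j : Fin n, (i : ℕ) < k → k ≤ (j : ℕ) → p j < p i) ↔
      ∀ y ∈ (quarterTurn p).take k, ∀ z ∈ (quarterTurn p).drop k, y < z := by
    intro k
    rw [hlist]
    constructor
    · intro h
      exact cut_symm fun i j hi hj => by simpa using h i j hi hj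
    · intro h i j hi hj
      simpa using cut_symm h i j hi hj
  have hlen : (quarterTurn p).length = n := (fills_quarterTurn p).length
  simp only [Indecomposable, DirectIndec, hcut, hlen, not_exists, not_and]

theorem numAvoiding_eq (n : ℕ) : numAvoiding pattern1342 n = (avoiders 0 n).card :=
  card_perm_eq (fun _ hl => (mem_avoiders.1 hl).1) fun p => by
    rw [avoids_iff, mem_avoiders]
    exact (and_iff_right (fills_quarterTurn p)).symm

theorem numIndecomposableAvoiding_eq {n : ℕ} (hn : 1 ≤ n) :
    numIndecomposableAvoiding pattern1342 n = (indecAvoiders n).card :=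
  card_perm_eq (fun _ hl => (mem_indecAvoiders.1 hl).1.1) fun p => by
    have hf := fills_quarterTurn p
    have hne : quarterTurn p ≠ [] := fun h => by
      have := hf.length
      rw [h] at this
      simp at this
      omega
    rw [avoids_iff, indecomposable_iff, mem_indecAvoiders]
    tauto

/-! ### The formal power series -/

theorem H_eq : H = Y (1 : ℚ) := by
  ext n
  rw [H, PowerSeries.coeff_mk, numAvoiding_eq, card_avoiders_eq_coeff]

theorem isFormalSum_geometric {f g : ℚ⟦X⟧} (hf : PowerSeries.constantCoeff f = 0)
    (h : g * (1 - f) = 1) : IsFormalSum (fun i => f ^ i) g := by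
  intro n
  refine ⟨n + 1, fun M hM => ?_⟩
  have h1 : g - ∑ i ∈ Finset.range M, f ^ i = f ^ M * g := by
    have h2 := geom_sum_mul_neg f M
    linear_combination (∑ i ∈ Finset.range M, f ^ i) * h - g * h2
  have h3 : PowerSeries.X ^ M ∣ f ^ M * g :=
    (pow_dvd_pow_of_dvd (PowerSeries.X_dvd_iff.2 hf) M).mul_right g
  have h4 := PowerSeries.X_pow_dvd_iff.1 h3 n (by omega)
  rw [← h1, map_sub, sub_eq_zero] at h4
  exact h4.symm

end Avoid1342

theorem mainTheorem1 :
    (∀ n : ℕ, 1 ≤ n →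
      (Avoid1342.numIndecomposableAvoiding Avoid1342.pattern1342 n : ℚ) = Avoid1342.t n) ∧
    Avoid1342.toLaurent Avoid1342.F =
      (8 * Avoid1342.x ^ 2 + 12 * Avoid1342.x - 1 +
        Avoid1342.toLaurent Avoid1342.oneSubEightXPow) / (32 * Avoid1342.x) ∧
    Avoid1342.IsFormalSum (fun i => Avoid1342.F ^ i) Avoid1342.H ∧
    Avoid1342.toLaurent Avoid1342.H = 1 / (1 - Avoid1342.toLaurent Avoid1342.F) ∧
    Avoid1342.toLaurent Avoid1342.H =
      32 * Avoid1342.x / (-8 * Avoid1342.x ^ 2 + 20 * Avoid1342.x + 1 -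
        Avoid1342.toLaurent Avoid1342.oneSubEightXPow) := by
  open Avoid1342 in
  have hinj : Function.Injective (HahnSeries.ofPowerSeries ℤ ℚ) :=
    HahnSeries.ofPowerSeries_injective
  have hx : x ≠ 0 := by
    rw [x, toLaurent, Ne, map_eq_zero_iff _ hinj]
    exact PowerSeries.X_ne_zero
  have h32 : (32 : ℚ⸨X⸩) ≠ 0 := by
    have : (32 : ℚ⟦X⟧) ≠ 0 := fun h0 => by
      have := congrArg PowerSeries.constantCoeff h0
      rw [map_ofNat, map_zero] at this
      norm_num at this
    rwa [Ne, ← map_eq_zero_iff _ hinj, map_ofNat] at this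
  have hF : 32 * x * toLaurent F = 8 * x ^ 2 + 12 * x - 1 + toLaurent oneSubEightXPow := by
    have := congrArg (HahnSeries.ofPowerSeries ℤ ℚ) F_eq
    simp only [map_add, map_sub, map_mul, map_pow, map_one, map_ofNat] at this
    exact this
  have hH : toLaurent H * (1 - toLaurent F) = 1 := by
    have := congrArg (HahnSeries.ofPowerSeries ℤ ℚ) Y_one_mul_one_sub_F
    rw [← H_eq] at this
    simp only [map_sub, map_mul, map_one] at this
    exact this
  have hF0 : 1 - toLaurent F ≠ 0 := right_ne_zero_of_mul_eq_one hH
  refine ⟨fun n hn => ?_, ?_, ?_, ?_, ?_⟩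
  · have := congrArg (PowerSeries.coeff n) mk_card_indecAvoiders
    rw [F, PowerSeries.coeff_mk, PowerSeries.coeff_mk] at this
    rw [numIndecomposableAvoiding_eq hn, this]
  · rw [eq_div_iff (mul_ne_zero h32 hx), ← hF, mul_comm]
  · rw [H_eq]
    refine isFormalSum_geometric ?_ Y_one_mul_one_sub_F
    rw [← PowerSeries.coeff_zero_eq_constantCoeff_apply, F, PowerSeries.coeff_mk, t]
  · rw [eq_div_iff hF0, hH]
  · have hd : -8 * x ^ 2 + 20 * x + 1 - toLaurent oneSubEightXPow =
        32 * x * (1 - toLaurent F) := by linear_combination hF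
    rw [hd, eq_div_iff (mul_ne_zero (mul_ne_zero h32 hx) hF0)]
    linear_combination 32 * x * hH
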